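/- Let $d\ge 0$ be an integer, $0\le\alpha<1$, $0<m$, $M\in\mathbb R$, and let $H$ be a symmetric real $d\times d$ matrix with $mI\preceq H\preceq MI$ (that is, $H-mI$ and $MI-H$ are positive semidefinite). Let $c\in\mathbb R^d$, $U(x)=\tfrac12\langle x-c,H(x-c)\rangle$, and let $\pi=N(c,H^{-1})\otimes N(0,I_d)$ on $\mathbb R^d\times\mathbb R^d$ (so $\pi(x,v)\propto e^{-U(x)-|v|^2/2}$). Put $$\lambda_{\mathrm{ref}}=\frac{2\sqrt m}{1-\alpha},\qquad \mu=\frac{\sqrt m}{3}.$$ Randomized Hamiltonian Monte Carlo (RHMC) is the process $Z(t)=(X(t),V(t))$ that follows the Hamiltonian dynamics $x'=v$, $v'=-\nabla U(x)$ between the arrival times of a Poisson process of rate $\lambda_{\mathrm{ref}}$, at which the velocity $v$ is replaced by $\alpha v+\sqrt{1-\alpha^2}\,\xi$ with a fresh $\xi\sim N(0,I_d)$. Let $P^tf(z)=\mathbb E[f(Z(t))\mid Z(0)=z]$. In the synchronous coupling $(Z_1(t),Z_2(t))$ two such processes are refreshed at the same times with the same $\xi$; its generator is $$L_{1,2}F(z_1,z_2)=\sum_{i=1}^2\big(\langle\nabla_{x_i}F,v_i\rangle-\langle\nabla_{v_i}F,\nabla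 U(x_i)\rangle\big)+\lambda_{\mathrm{ref}}\Big(\mathbb E\,F\big((x_1,\alpha v_1+\sqrt{1-\alpha^2}\,\xi),(x_2,\alpha v_2+\sqrt{1-\alpha^2}\,\xi)\big)-F(z_1,z_2)\Big).$$ For a $2d\times2d$ matrix $D$ write $d_D^2(z_1,z_2)=\langle z_2-z_1,D(z_2-z_1)\rangle$. **Proposition.** (1) There is a symmetric positive definite real $2d\times 2d$ matrix $D$ such that for all $z_1,z_2\in\mathbb R^{2d}$ $$L_{1,2}\,d_D^2(z_1,z_2)\le-\mu\,d_D^2(z_1,z_2),$$ and, for the synchronously coupled processes started at $z_1,z_2$ and every $t\ge0$, $d_D^2(Z_1(t),Z_2(t))$ is integrable with $$\mathbb E\,d_D^2(Z_1(t),Z_2(t))\le e^{-\mu t}\,d_D^2(z_1,z_2).$$ (2) For every $f\in L^2(\pi)$ with $\int f\,d\pi=0$ and every $t\ge0$, $P^tf\in L^2(\pi)$ and $$\|P^tf\|_{L^2(\pi)}^2\le\min\big(Ce^{-\mu t},1\big)\,\|f\|_{L^2(\pi)}^2,\qquad C=\frac{\bar a\bar c+\bar b^2+2\sqrt{\bar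 a\bar c\,\bar b^2}}{\bar a\bar c-\bar b^2}\ \text{ with }(\bar a,\bar b,\bar c)=(1,\tfrac14,1),\ \text{ i.e. } C=\tfrac53 .$$ -/

import Mathlib

open MeasureTheory ProbabilityTheory

noncomputable section

namespace RHMC

/-- Positions (or velocities): `ℝᵈ` with its Euclidean norm. -/
abbrev Vec (d : ℕ) : Type := EuclideanSpace ℝ (Fin d)

/-- Phase space `ℝᵈ × ℝᵈ`; a point is `z = (x, v)` with position `x` and velocity `v`. -/
abbrev Phase (d : ℕ) : Type := Vec d × Vec d

variable {d : ℕ}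

/-- The linear map of `ℝᵈ` given by a `d × d` matrix. -/
def act (H : Matrix (Fin d) (Fin d) ℝ) : Vec d →L[ℝ] Vec d :=
  Matrix.toEuclideanCLM (n := Fin d) (𝕜 := ℝ) H

/-- The potential `U(x) = ½ ⟨x - c, H (x - c)⟩` of the Gaussian with mean `c` and precision
(inverse covariance) matrix `H`, that is minus the logarithm of its density, up to an additive
constant. -/
def gaussianPotential (H : Matrix (Fin d) (Fin d) ℝ) (c : Vec d) (x : Vec d) : ℝ :=
  1 / 2 * inner ℝ (x - c) (act H (x - c))

/-- The Gaussian target on phase space: the position has law `N(c, H⁻¹)` and, independently, the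
velocity has law `N(0, I)`. -/
def target (H : Matrix (Fin d) (Fin d) ℝ) (c : Vec d) : Measure (Phase d) :=
  (multivariateGaussian c H⁻¹).prod (stdGaussian (Vec d))

/-- The Hamiltonian vector field `(v, -∇U(x))`. -/
def hamiltonianField (U : Vec d → ℝ) (z : Phase d) : Phase d :=
  (z.2, -gradient U z.1)

/-- The linear part `(x, v) ↦ (v, -H x)` of the Hamiltonian vector field of a Gaussian. -/
def fieldCLM (H : Matrix (Fin d) (Fin d) ℝ) : Phase d →L[ℝ] Phase d :=
  (ContinuousLinearMap.snd ℝ (Vec d) (Vec d)).prod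
    (-((act H).comp (ContinuousLinearMap.fst ℝ (Vec d) (Vec d))))

/-- The Hamiltonian flow for the potential `gaussianPotential H c`; see `flow_zero` and
`hasDerivAt_flow`. -/
def flow (H : Matrix (Fin d) (Fin d) ℝ) (c : Vec d) (t : ℝ) (z : Phase d) : Phase d :=
  (c, 0) + NormedSpace.exp (t • fieldCLM H) (z - (c, 0))

theorem hasGradientAt_gaussianPotential {H : Matrix (Fin d) (Fin d) ℝ} (hH : H.IsHermitian)
    (c x : Vec d) : HasGradientAt (gaussianPotential H c) (act H (x - c)) x := by
  have hsymm : ∀ u w : Vec d, inner ℝ u (act H w) = inner ℝ (act H u) w := by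
    intro u w
    have h := (Matrix.isSymmetric_toEuclideanLin_iff (𝕜 := ℝ) (A := H)).2 hH
    exact (h u w).symm
  have h1 : HasFDerivAt (fun y : Vec d => y - c) (ContinuousLinearMap.id ℝ (Vec d)) x :=
    (hasFDerivAt_id x).sub_const c
  have h2 : HasFDerivAt (fun y : Vec d => act H (y - c)) (act H) x := by
    have h := (act H).hasFDerivAt.comp x h1
    rwa [ContinuousLinearMap.comp_id] at h
  have h3 := (h1.inner ℝ h2).const_mul (1 / 2 : ℝ)
  rw [hasGradientAt_iff_hasFDerivAt]
  refine h3.congr_fderiv ?_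
  ext y
  have e1 : inner ℝ (x - c) (act H y) = inner ℝ (act H (x - c)) y := hsymm _ _
  have e2 : inner ℝ y (act H (x - c)) = inner ℝ (act H (x - c)) y := real_inner_comm _ _
  change 1 / 2 * (inner ℝ (x - c) (act H y) + inner ℝ y (act H (x - c)))
    = inner ℝ (act H (x - c)) y
  rw [e1, e2]
  ring

theorem flow_zero (H : Matrix (Fin d) (Fin d) ℝ) (c : Vec d) (z : Phase d) :
    flow H c 0 z = z := by
  have h : (0 : ℝ) • fieldCLM H = 0 := by
    ext <;> simp
  rw [flow, h, NormedSpace.exp_zero]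
  simp

/-- `t ↦ flow H c t z` solves Hamilton's equations `x' = v`, `v' = -∇U(x)`. -/
theorem hasDerivAt_flow {H : Matrix (Fin d) (Fin d) ℝ} (hH : H.IsHermitian) (c : Vec d)
    (z : Phase d) (t : ℝ) :
    HasDerivAt (fun s => flow H c s z)
      (hamiltonianField (gaussianPotential H c) (flow H c t z)) t := by
  have h1 := hasDerivAt_exp_smul_const' (𝕂 := ℝ) (fieldCLM H) t
  have h2 := (h1.clm_apply (hasDerivAt_const t (z - ((c, 0) : Phase d)))).const_add
    ((c, 0) : Phase d)
  refine h2.congr_deriv ?_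
  simp [hamiltonianField, (hasGradientAt_gaussianPotential hH c _).gradient, flow, fieldCLM]

/-- Autoregressive refreshment of the velocity by the noise `ξ`. -/
def refresh (α : ℝ) (ξ : Vec d) (z : Phase d) : Phase d :=
  (z.1, α • z.2 + Real.sqrt (1 - α ^ 2) • ξ)

/-- The law of the driving noise: an i.i.d. sequence of pairs, consisting of an exponential waiting
time of rate `lam` and an independent standard normal vector. -/
def noise (d : ℕ) (lam : ℝ) : Measure (ℕ → ℝ × Vec d) :=
  Measure.infinitePi fun _ => (expMeasure lam).prod (stdGaussian (Vec d))

/-- The time of the `n`-th refreshment (`0` for `n = 0`). -/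
def refreshTime (ω : ℕ → ℝ × Vec d) (n : ℕ) : ℝ := ∑ i ∈ Finset.range n, (ω i).1

/-- The state immediately after the `n`-th refreshment (the initial state for `n = 0`). -/
def skeleton (H : Matrix (Fin d) (Fin d) ℝ) (c : Vec d) (α : ℝ) (ω : ℕ → ℝ × Vec d)
    (z : Phase d) : ℕ → Phase d
  | 0 => z
  | n + 1 => refresh α (ω n).2 (flow H c (ω n).1 (skeleton H c α ω z n))

/-- The number of refreshments up to time `t`. -/
def refreshCount (ω : ℕ → ℝ × Vec d) (t : ℝ) : ℕ := sInf {n : ℕ | t < refreshTime ω (n + 1)}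

/-- The RHMC path started at `z`: Hamiltonian flow between the arrival times of a Poisson process,
autoregressive velocity refreshment at those times. Two paths with the same `ω` and different
starting points are the synchronous coupling: they are refreshed at the same times with the same
normal vectors. -/
def path (H : Matrix (Fin d) (Fin d) ℝ) (c : Vec d) (α : ℝ) (z : Phase d) (t : ℝ)
    (ω : ℕ → ℝ × Vec d) : Phase d :=
  flow H c (t - refreshTime ω (refreshCount ω t)) (skeleton H c α ω z (refreshCount ω t))

/-- The RHMC semigroup `Pᵗ f(z) = 𝔼 f(Z_t)`, where `Z_0 = z`. -/
def semigroup (H : Matrix (Fin d) (Fin d) ℝ) (c : Vec d) (α lam t : ℝ) (f : Phase d → ℝ)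
    (z : Phase d) : ℝ :=
  ∫ ω, f (path H c α z t ω) ∂(noise d lam)

/-- The generator `L₁,₂` of the synchronously coupled pair of RHMC processes with potential `U`:
both components follow Hamiltonian dynamics and, at rate `lam`, both velocities are refreshed with
the same normal vector. -/
def coupledGenerator (U : Vec d → ℝ) (α lam : ℝ) (F : Phase d × Phase d → ℝ)
    (p : Phase d × Phase d) : ℝ :=
  fderiv ℝ F p (hamiltonianField U p.1, hamiltonianField U p.2)
    + lam * ((∫ ξ, F (refresh α ξ p.1, refresh α ξ p.2) ∂(stdGaussian (Vec d))) - F p)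

/-- The squared distance `d_D²(z₁, z₂) = ⟨z₂ - z₁, D (z₂ - z₁)⟩` given by a `2d × 2d` matrix; the
left summand of the index type holds position coordinates, the right one velocity coordinates. -/
def sqDist (D : Matrix (Fin d ⊕ Fin d) (Fin d ⊕ Fin d) ℝ) (p : Phase d × Phase d) : ℝ :=
  let w : Fin d ⊕ Fin d → ℝ := Sum.elim (fun i => (p.2.1 - p.1.1) i) (fun i => (p.2.2 - p.1.2) i)
  dotProduct w (D.mulVec w)

/-- The constant `(ac + b² + 2√(acb²)) / (ac - b²)`. -/
def decayConst (a b c : ℝ) : ℝ :=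
  (a * c + b ^ 2 + 2 * Real.sqrt (a * c * b ^ 2)) / (a * c - b ^ 2)

end RHMC

end

/-!
Contraction of randomized Hamiltonian Monte Carlo with a Gaussian target.

*Distance.* Write `w = (x, v)` for the difference of the two synchronously coupled processes. The
refreshment noise cancels in `w`, which follows the linear field `(x, v) ↦ (v, -H x)` and has its
velocity multiplied by `α` at the refreshments. The quadratic form
`⟨x, H x⟩ + (√m / 2) ⟨x, v⟩ + |v|²` (`crossEnergy`) works as squared distance: its first and last
terms add up to a conserved quantity of the linear field, so that no bound depending on the largest
eigenvalue of `H` enters, the refreshment damps `|v|²`, and the cross term transfers dissipation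
to the positions. The infinitesimal contraction `crossEnergyDeriv_fieldCLM_add_le` reduces by
`H ≥ m` to a positive definite binary quadratic form in `√m |x|` and `|v|`.

*From the generator to the process.* Expectations are split according to the number `n` of
refreshments up to time `t` (`jumpExp`). Conditioning on the first refreshment gives a recursion in
`n` (`jumpExp_succ`), and Duhamel's formula (`crossEnergy_duhamel_le`) turns the infinitesimal
contraction into the statement that the bound `exp (-μ t)` passes through this recursion. The sum
over `n` is the full expectation because refreshment times almost surely do not accumulate
(`ae_exists_lt_refreshTime`).

*`L²` decay.* The adjoint of the transition kernel `P` in `L²(π)` is `S P S`, where `S` flips the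
velocity (`lintegral_mul_transition`). Indeed the flow preserves `π` and is reversed by `S`, the
refreshment is reversible, and the recursion over the first refreshment can equally be run over
the last one (`jumpExp_succ_last`). The form above changes at most by the factor `5/3` under `S`,
so the self-adjoint operator `S P S P` multiplies Lipschitz constants by at most
`κ = (5/3) exp (-μ t)`. Lipschitz functions of mean zero therefore decay in `L²` at rate `κ` under
its iterates. The squared norms of these iterates are log-convex by Cauchy-Schwarz, which forces
`‖P f‖² = ⟨f, S P S P f⟩ ≤ κ ‖f‖²` without any loss in the constant
(`IsDual.integral_sq_kernelOp_le`), and density extends the bound to all of `L²`.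
-/

namespace RHMC

open scoped ENNReal

/-! ### The driving noise -/

/-- The law of one waiting time together with its normal vector. -/
noncomputable def stepLaw (d : ℕ) (lam : ℝ) : Measure (ℝ × Vec d) :=
  (expMeasure lam).prod (stdGaussian (Vec d))

/-- Prepend an element to a sequence. -/
def consSeq {X : Type*} (q : X × (ℕ → X)) : ℕ → X
  | 0 => q.1
  | n + 1 => q.2 n

theorem measurable_consSeq {X : Type*} [MeasurableSpace X] :
    Measurable (consSeq : X × (ℕ → X) → ℕ → X) := by
  refine measurable_pi_lambda _ fun n => ?_
  cases n with
  | zero => exact measurable_fst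
  | succ n => exact (measurable_pi_apply n).comp measurable_snd

/-- An i.i.d. sequence is an independent pair of its first element and an i.i.d. sequence. -/
theorem map_consSeq_infinitePi {X : Type*} [MeasurableSpace X] (ν : Measure X)
    [IsProbabilityMeasure ν] :
    (ν.prod (Measure.infinitePi fun _ : ℕ => ν)).map consSeq
      = Measure.infinitePi fun _ : ℕ => ν := by
  classical
  refine Measure.eq_infinitePi _ fun s t ht => ?_
  obtain ⟨N, hN⟩ : ∃ N, s ⊆ Finset.range (N + 1) :=
    ⟨s.sup id, fun i hi => Finset.mem_range_succ_iff.2 (Finset.le_sup (f := id) hi)⟩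
  -- enlarge the box to one over an initial segment of indices
  set u : ℕ → Set X := fun i => if i ∈ s then t i else Set.univ with hu
  have hum : ∀ i, MeasurableSet (u i) := by
    intro i
    by_cases hi : i ∈ s <;> simp [hu, hi, ht]
  have h1 : Set.pi (s : Set ℕ) t = Set.pi (Finset.range (N + 1) : Set ℕ) u := by
    ext x
    simp only [Set.mem_pi, Finset.mem_coe, hu]
    constructor
    · intro h i _
      by_cases hi : i ∈ s <;> simp [hi, h]
    · intro h i hi
      simpa [hi] using h i (hN hi)
  have h2 : ∏ i ∈ s, ν (t i) = ∏ i ∈ Finset.range (N + 1), ν (u i) := by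
    rw [← Finset.prod_subset hN]
    · exact Finset.prod_congr rfl fun i hi => by simp [hu, hi]
    · intro i _ hi
      simp [hu, hi]
  have h3 : consSeq ⁻¹' (Set.pi (Finset.range (N + 1) : Set ℕ) u)
      = u 0 ×ˢ Set.pi (Finset.range N : Set ℕ) fun i => u (i + 1) := by
    ext q
    simp only [Set.mem_preimage, Set.mem_pi, Finset.mem_coe, Finset.mem_range, Set.mem_prod]
    constructor
    · intro h
      exact ⟨h 0 (by omega), fun i hi => h (i + 1) (by omega)⟩
    · rintro ⟨h0, h⟩ i hi
      cases i with
      | zero => exact h0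
      | succ i => exact h i (by omega)
  rw [h1, h2, Measure.map_apply measurable_consSeq
    (MeasurableSet.pi (Finset.countable_toSet _) fun i _ => hum i), h3, Measure.prod_prod,
    Measure.infinitePi_pi _ fun i _ => hum (i + 1), Finset.prod_range_succ', mul_comm]

section

variable {d : ℕ} {lam : ℝ}

instance [IsProbabilityMeasure (expMeasure lam)] : IsProbabilityMeasure (stepLaw d lam) := by
  unfold stepLaw; infer_instance

instance [IsProbabilityMeasure (expMeasure lam)] : IsProbabilityMeasure (noise d lam) := by
  change IsProbabilityMeasure (Measure.infinitePi fun _ => stepLaw d lam)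
  infer_instance

theorem lintegral_noise [IsProbabilityMeasure (expMeasure lam)] {G : (ℕ → ℝ × Vec d) → ℝ≥0∞}
    (hG : Measurable G) :
    ∫⁻ ω, G ω ∂(noise d lam)
      = ∫⁻ p, ∫⁻ ω, G (consSeq (p, ω)) ∂(noise d lam) ∂(stepLaw d lam) := by
  have h : noise d lam = ((stepLaw d lam).prod (noise d lam)).map consSeq :=
    (map_consSeq_infinitePi (stepLaw d lam)).symm
  conv_lhs => rw [h]
  rw [lintegral_map hG measurable_consSeq]
  exact lintegral_prod _ (hG.comp measurable_consSeq).aemeasurable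

theorem measurable_exponentialPDF : Measurable (exponentialPDF lam) :=
  (measurable_exponentialPDFReal lam).ennreal_ofReal

theorem lintegral_expMeasure (g : ℝ → ℝ≥0∞) (hg : Measurable g) :
    ∫⁻ s, g s ∂(expMeasure lam) = ∫⁻ s, exponentialPDF lam s * g s :=
  lintegral_withDensity_eq_lintegral_mul _
    measurable_exponentialPDF hg

theorem lintegral_stepLaw {g : ℝ × Vec d → ℝ≥0∞} (hg : Measurable g) :
    ∫⁻ p, g p ∂(stepLaw d lam)
      = ∫⁻ s, exponentialPDF lam s * ∫⁻ ξ, g (s, ξ) ∂(stdGaussian (Vec d)) := by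
  rw [stepLaw, lintegral_prod _ hg.aemeasurable, lintegral_expMeasure _ hg.lintegral_prod_right']

theorem ae_noise_nonneg [IsProbabilityMeasure (expMeasure lam)] :
    ∀ᵐ ω ∂(noise d lam), ∀ n, 0 ≤ (ω n).1 := by
  rw [ae_all_iff]
  intro n
  have h1 : ∀ᵐ s ∂(expMeasure lam), 0 ≤ s := by
    have h : expMeasure lam = volume.withDensity (exponentialPDF lam) := rfl
    rw [ae_iff]
    simp only [not_le]
    change expMeasure lam (Set.Iio 0) = 0
    rw [h, withDensity_apply _ measurableSet_Iio]
    exact lintegral_exponentialPDF_of_nonpos le_rfl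
  have h2 : ∀ᵐ p ∂(stepLaw d lam), 0 ≤ p.1 :=
    Measure.quasiMeasurePreserving_fst.ae h1
  exact (measurePreserving_eval_infinitePi (fun _ : ℕ => stepLaw d lam)
    n).quasiMeasurePreserving.ae h2

theorem measurable_refreshTime (n : ℕ) :
    Measurable fun ω : ℕ → ℝ × Vec d => refreshTime ω n :=
  Finset.measurable_sum _ fun i _ => measurable_fst.comp (measurable_pi_apply i)

theorem refreshTime_consSeq (p : ℝ × Vec d) (ω : ℕ → ℝ × Vec d) (n : ℕ) :
    refreshTime (consSeq (p, ω)) (n + 1) = p.1 + refreshTime ω n := by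
  rw [refreshTime, Finset.sum_range_succ', add_comm]
  rfl

/-- The Laplace transform at `1` of the `n`-th refreshment time. -/
theorem lintegral_exp_neg_refreshTime (hlam : 0 < lam) [IsProbabilityMeasure (expMeasure lam)]
    (n : ℕ) :
    ∫⁻ ω, ENNReal.ofReal (Real.exp (-refreshTime ω n)) ∂(noise d lam)
      = ENNReal.ofReal (lam / (lam + 1)) ^ n := by
  have hm : ∀ n, Measurable fun ω : ℕ → ℝ × Vec d =>
      ENNReal.ofReal (Real.exp (-refreshTime ω n)) := fun n =>
    (Real.measurable_exp.comp (measurable_refreshTime n).neg).ennreal_ofReal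
  induction n with
  | zero => simp [refreshTime]
  | succ n ih =>
    rw [lintegral_noise (hm _)]
    have h1 : ∀ p : ℝ × Vec d, ∫⁻ ω, ENNReal.ofReal (Real.exp
        (-refreshTime (consSeq (p, ω)) (n + 1))) ∂(noise d lam)
        = ENNReal.ofReal (Real.exp (-p.1)) * ENNReal.ofReal (lam / (lam + 1)) ^ n := by
      intro p
      rw [← ih, ← lintegral_const_mul _ (hm n)]
      refine lintegral_congr fun ω => ?_
      rw [refreshTime_consSeq, neg_add, Real.exp_add, ENNReal.ofReal_mul (Real.exp_nonneg _)]
    simp_rw [h1]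
    have hm2 : Measurable fun p : ℝ × Vec d => ENNReal.ofReal (Real.exp (-p.1)) := by fun_prop
    rw [lintegral_mul_const _ hm2, pow_succ, mul_comm]
    congr 1
    rw [lintegral_stepLaw hm2]
    have h2 : ∀ s : ℝ, exponentialPDF lam s * ∫⁻ _ : Vec d, ENNReal.ofReal (Real.exp (-s))
        ∂(stdGaussian (Vec d))
        = ENNReal.ofReal (lam / (lam + 1)) * exponentialPDF (lam + 1) s := by
      intro s
      rw [lintegral_const, measure_univ, mul_one]
      rcases lt_or_ge s 0 with hs | hs
      · simp [exponentialPDF_of_neg hs]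
      · rw [exponentialPDF_of_nonneg hs, exponentialPDF_of_nonneg hs,
          ← ENNReal.ofReal_mul (by positivity), ← ENNReal.ofReal_mul (by positivity), mul_assoc,
          ← Real.exp_add]
        congr 1
        have : -(lam * s) + -s = -((lam + 1) * s) := by ring
        rw [this]
        field_simp
    simp_rw [h2]
    rw [lintegral_const_mul' _ _ ENNReal.ofReal_ne_top,
      lintegral_exponentialPDF_eq_one (by linarith), mul_one]

/-- Almost surely there are only finitely many refreshments up to time `t`. -/
theorem ae_exists_lt_refreshTime (hlam : 0 < lam) [IsProbabilityMeasure (expMeasure lam)]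
    (t : ℝ) : ∀ᵐ ω ∂(noise d lam), ∃ n, t < refreshTime ω (n + 1) := by
  rw [ae_iff]
  simp only [not_exists, not_lt]
  set A := {ω : ℕ → ℝ × Vec d | ∀ n, refreshTime ω (n + 1) ≤ t}
  have hr : ENNReal.ofReal (lam / (lam + 1)) < 1 := by
    rw [← ENNReal.ofReal_one, ENNReal.ofReal_lt_ofReal_iff one_pos, div_lt_one (by linarith)]
    linarith
  -- Markov's inequality for `exp (-T_n)`
  have hb : ∀ n : ℕ, ENNReal.ofReal (Real.exp (-t)) * noise d lam A
      ≤ ENNReal.ofReal (lam / (lam + 1)) ^ (n + 1) := by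
    intro n
    rw [← lintegral_exp_neg_refreshTime (d := d) hlam (n + 1)]
    refine le_trans ?_ (mul_meas_ge_le_lintegral (Real.measurable_exp.comp
      (measurable_refreshTime (n + 1)).neg).ennreal_ofReal (ENNReal.ofReal (Real.exp (-t))))
    gcongr
    intro ω hω
    exact ENNReal.ofReal_le_ofReal (Real.exp_le_exp.2 (neg_le_neg (hω n)))
  have h0 : ENNReal.ofReal (Real.exp (-t)) * noise d lam A ≤ 0 :=
    ge_of_tendsto' ((ENNReal.tendsto_pow_atTop_nhds_zero_of_lt_one hr).comp
      (Filter.tendsto_add_atTop_nat 1)) hb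
  have h1 := le_antisymm h0 zero_le
  rcases mul_eq_zero.1 h1 with h | h
  · exact absurd h (by simpa using Real.exp_pos _)
  · exact h

end

/-! ### Piecewise deterministic jump processes -/

section

variable {d : ℕ} {lam : ℝ} {Y : Type*}

/-- The state after `n` jumps of the process that follows `φ` and jumps by `r` with the waiting
times and normal vectors in `ω`. -/
def jumpSkeleton (φ : ℝ → Y → Y) (r : Vec d → Y → Y) (ω : ℕ → ℝ × Vec d) (y : Y) : ℕ → Y
  | 0 => y
  | n + 1 => r (ω n).2 (φ (ω n).1 (jumpSkeleton φ r ω y n))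

/-- The process that follows `φ` and jumps by `r` at the refreshment times. -/
noncomputable def jumpPath (φ : ℝ → Y → Y) (r : Vec d → Y → Y) (y : Y) (t : ℝ)
    (ω : ℕ → ℝ × Vec d) : Y :=
  φ (t - refreshTime ω (refreshCount ω t)) (jumpSkeleton φ r ω y (refreshCount ω t))

open Classical in
/-- The value of `f` at time `t` on the event that exactly `n` jumps have occurred. -/
noncomputable def jumpTerm (φ : ℝ → Y → Y) (r : Vec d → Y → Y) (n : ℕ) (t : ℝ) (f : Y → ℝ≥0∞)
    (y : Y) (ω : ℕ → ℝ × Vec d) : ℝ≥0∞ :=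
  if refreshTime ω n ≤ t ∧ t < refreshTime ω (n + 1) then
    f (φ (t - refreshTime ω n) (jumpSkeleton φ r ω y n)) else 0

/-- `𝔼[f(Y_t); N_t = n]`, where `N_t` is the number of jumps up to time `t`. -/
noncomputable def jumpExp (lam : ℝ) (φ : ℝ → Y → Y) (r : Vec d → Y → Y) (n : ℕ) (t : ℝ)
    (f : Y → ℝ≥0∞) (y : Y) : ℝ≥0∞ :=
  ∫⁻ ω, jumpTerm φ r n t f y ω ∂(noise d lam)

variable {φ : ℝ → Y → Y} {r : Vec d → Y → Y}

theorem jumpSkeleton_consSeq (p : ℝ × Vec d) (ω : ℕ → ℝ × Vec d) (y : Y) (n : ℕ) :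
    jumpSkeleton φ r (consSeq (p, ω)) y (n + 1) = jumpSkeleton φ r ω (r p.2 (φ p.1 y)) n := by
  induction n with
  | zero => rfl
  | succ n ih =>
    rw [jumpSkeleton, ih]
    rfl

theorem jumpTerm_consSeq (p : ℝ × Vec d) (ω : ℕ → ℝ × Vec d) (n : ℕ) (t : ℝ) (f : Y → ℝ≥0∞)
    (y : Y) :
    jumpTerm φ r (n + 1) t f y (consSeq (p, ω))
      = jumpTerm φ r n (t - p.1) f (r p.2 (φ p.1 y)) ω := by
  simp only [jumpTerm, refreshTime_consSeq, jumpSkeleton_consSeq, le_sub_iff_add_le',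
    sub_lt_iff_lt_add', sub_sub]

theorem jumpExp_of_neg [IsProbabilityMeasure (expMeasure lam)] {t : ℝ} (ht : t < 0) (n : ℕ)
    (f : Y → ℝ≥0∞) (y : Y) : jumpExp lam φ r n t f y = 0 := by
  rw [jumpExp, ← lintegral_zero (μ := noise d lam)]
  refine lintegral_congr_ae ?_
  filter_upwards [ae_noise_nonneg] with ω hω
  have : 0 ≤ refreshTime ω n := Finset.sum_nonneg fun i _ => hω i
  rw [jumpTerm, if_neg]
  rintro ⟨h, -⟩
  linarith

variable [MeasurableSpace Y]

theorem measurable_jumpSkeleton (hφ : Measurable fun q : ℝ × Y => φ q.1 q.2)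
    (hr : Measurable fun q : Vec d × Y => r q.1 q.2) (n : ℕ) :
    Measurable fun q : (ℕ → ℝ × Vec d) × Y => jumpSkeleton φ r q.1 q.2 n := by
  induction n with
  | zero => exact measurable_snd
  | succ n ih =>
    have h1 : Measurable fun q : (ℕ → ℝ × Vec d) × Y => q.1 n :=
      (measurable_pi_apply n).comp measurable_fst
    exact hr.comp (h1.snd.prodMk (hφ.comp (h1.fst.prodMk ih)))

theorem measurable_jumpTerm {A : Type*} [MeasurableSpace A]
    (hφ : Measurable fun q : ℝ × Y => φ q.1 q.2)
    (hr : Measurable fun q : Vec d × Y => r q.1 q.2) (n : ℕ) {t : A → ℝ} (ht : Measurable t)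
    {f : A → Y → ℝ≥0∞} (hf : Measurable fun q : A × Y => f q.1 q.2) {y : A → Y}
    (hy : Measurable y) :
    Measurable fun q : A × (ℕ → ℝ × Vec d) => jumpTerm φ r n (t q.1) (f q.1) (y q.1) q.2 := by
  have hT : ∀ n, Measurable fun q : A × (ℕ → ℝ × Vec d) => refreshTime q.2 n := fun n =>
    (measurable_refreshTime n).comp measurable_snd
  have ht' : Measurable fun q : A × (ℕ → ℝ × Vec d) => t q.1 := ht.comp measurable_fst
  refine Measurable.ite ((measurableSet_le (hT n) ht').inter (measurableSet_lt ht' (hT (n + 1))))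
    ?_ measurable_const
  exact hf.comp (measurable_fst.prodMk (hφ.comp ((ht'.sub (hT n)).prodMk
    ((measurable_jumpSkeleton hφ hr n).comp
      (measurable_snd.prodMk (hy.comp measurable_fst))))))

theorem measurable_jumpExp {A : Type*} [MeasurableSpace A]
    [IsProbabilityMeasure (expMeasure lam)]
    (hφ : Measurable fun q : ℝ × Y => φ q.1 q.2)
    (hr : Measurable fun q : Vec d × Y => r q.1 q.2) (n : ℕ) {t : A → ℝ} (ht : Measurable t)
    {f : A → Y → ℝ≥0∞} (hf : Measurable fun q : A × Y => f q.1 q.2) {y : A → Y}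
    (hy : Measurable y) :
    Measurable fun a => jumpExp lam φ r n (t a) (f a) (y a) :=
  (measurable_jumpTerm hφ hr n ht hf hy).lintegral_prod_right'

theorem measurable_jumpTerm_right (hφ : Measurable fun q : ℝ × Y => φ q.1 q.2)
    (hr : Measurable fun q : Vec d × Y => r q.1 q.2) (n : ℕ) (t : ℝ)
    {f : Y → ℝ≥0∞} (hf : Measurable f) (y : Y) : Measurable (jumpTerm φ r n t f y) :=
  (measurable_jumpTerm (A := Unit) hφ hr n (t := fun _ => t) measurable_const
    (f := fun _ => f) (hf.comp measurable_snd) (y := fun _ => y) measurable_const).comp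
    (measurable_const (a := ()).prodMk measurable_id)

theorem lintegral_exponentialPDF_Ioi (hlam : 0 < lam) [IsProbabilityMeasure (expMeasure lam)]
    {t : ℝ} (ht : 0 ≤ t) :
    ∫⁻ s in Set.Ioi t, exponentialPDF lam s = ENNReal.ofReal (Real.exp (-(lam * t))) := by
  have h := lintegral_add_compl (μ := volume) (exponentialPDF lam) (measurableSet_Iic (a := t))
  rw [lintegral_exponentialPDF_eq_antiDeriv hlam, lintegral_exponentialPDF_eq_one hlam,
    if_pos ht, Set.compl_Iic] at h
  have he : Real.exp (-(lam * t)) ≤ 1 := Real.exp_le_one_iff.2 (by nlinarith)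
  have h1 : (1 : ℝ≥0∞) = ENNReal.ofReal (1 - Real.exp (-(lam * t)))
      + ENNReal.ofReal (Real.exp (-(lam * t))) := by
    rw [← ENNReal.ofReal_add (by linarith) (Real.exp_nonneg _)]
    simp
  rw [h1] at h
  exact (ENNReal.add_right_inj ENNReal.ofReal_ne_top).1 h

theorem jumpExp_zero (hlam : 0 < lam) [IsProbabilityMeasure (expMeasure lam)]
    (hφ : Measurable fun q : ℝ × Y => φ q.1 q.2)
    (hr : Measurable fun q : Vec d × Y => r q.1 q.2) {t : ℝ} (ht : 0 ≤ t)
    {f : Y → ℝ≥0∞} (hf : Measurable f) (y : Y) :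
    jumpExp lam φ r 0 t f y = ENNReal.ofReal (Real.exp (-(lam * t))) * f (φ t y) := by
  rw [jumpExp, lintegral_noise (measurable_jumpTerm_right hφ hr 0 t hf y)]
  have h1 : ∀ p : ℝ × Vec d, ∫⁻ ω, jumpTerm φ r 0 t f y (consSeq (p, ω)) ∂(noise d lam)
      = (Set.Ioi t).indicator (fun _ => f (φ t y)) p.1 := by
    intro p
    have h2 : ∀ ω, jumpTerm φ r 0 t f y (consSeq (p, ω))
        = (Set.Ioi t).indicator (fun _ => f (φ t y)) p.1 := by
      intro ω
      simp only [jumpTerm, refreshTime_consSeq]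
      simp [refreshTime, ht, jumpSkeleton, Set.indicator]
    simp [h2]
  simp_rw [h1]
  have hm : Measurable ((Set.Ioi t).indicator fun _ : ℝ => f (φ t y)) :=
    measurable_const.indicator measurableSet_Ioi
  rw [lintegral_stepLaw (g := fun p => (Set.Ioi t).indicator (fun _ => f (φ t y)) p.1)
    (hm.comp measurable_fst)]
  simp only [lintegral_const, measure_univ, mul_one]
  rw [← lintegral_exponentialPDF_Ioi hlam ht, ← lintegral_mul_const _
    measurable_exponentialPDF, ← lintegral_indicator measurableSet_Ioi]
  refine lintegral_congr fun s => ?_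
  by_cases hs : s ∈ Set.Ioi t <;> simp [hs]

/-- Decomposition at the first jump. -/
theorem jumpExp_succ [IsProbabilityMeasure (expMeasure lam)]
    (hφ : Measurable fun q : ℝ × Y => φ q.1 q.2)
    (hr : Measurable fun q : Vec d × Y => r q.1 q.2) (n : ℕ) (t : ℝ)
    {f : Y → ℝ≥0∞} (hf : Measurable f) (y : Y) :
    jumpExp lam φ r (n + 1) t f y
      = ∫⁻ p, jumpExp lam φ r n (t - p.1) f (r p.2 (φ p.1 y)) ∂(stepLaw d lam) := by
  rw [jumpExp, lintegral_noise (measurable_jumpTerm_right hφ hr _ t hf y)]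
  simp only [jumpTerm_consSeq, jumpExp]

/-- Decomposition at the last jump. -/
theorem jumpExp_succ_last (hlam : 0 < lam) [IsProbabilityMeasure (expMeasure lam)]
    (hφ : Measurable fun q : ℝ × Y => φ q.1 q.2)
    (hr : Measurable fun q : Vec d × Y => r q.1 q.2) (n : ℕ) (t : ℝ)
    {f : Y → ℝ≥0∞} (hf : Measurable f) (y : Y) :
    jumpExp lam φ r (n + 1) t f y
      = ∫⁻ p, jumpExp lam φ r n (t - p.1) (fun z => f (φ p.1 (r p.2 z))) y
          ∂(stepLaw d lam) := by
  have hstep : Measurable fun q : (ℝ × Vec d) × Y => φ q.1.1 (r q.1.2 q.2) :=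
    hφ.comp (measurable_fst.fst.prodMk (hr.comp (measurable_fst.snd.prodMk measurable_snd)))
  have hstep' : ∀ y : Y, Measurable fun p : ℝ × Vec d => r p.2 (φ p.1 y) := fun y =>
    hr.comp (measurable_snd.prodMk (hφ.comp (measurable_fst.prodMk measurable_const)))
  have hts : Measurable fun p : ℝ × Vec d => t - p.1 := measurable_const.sub measurable_fst
  induction n generalizing t y with
  | zero =>
    rw [jumpExp_succ hφ hr 0 t hf y,
      lintegral_stepLaw (measurable_jumpExp hφ hr 0 hts (hf.comp measurable_snd) (hstep' y)),
      lintegral_stepLaw (measurable_jumpExp hφ hr 0 hts (hf.comp hstep)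
        (y := fun _ => y) measurable_const),
      ← lintegral_sub_left_eq_self _ t]
    refine lintegral_congr fun s => ?_
    rcases lt_or_ge s 0 with hs | hs
    · simp only [exponentialPDF_of_neg hs, zero_mul]
      rw [← mul_zero (exponentialPDF lam (t - s)),
        ← lintegral_zero (μ := stdGaussian (Vec d))]
      congr 1
      refine lintegral_congr fun ξ => jumpExp_of_neg (by linarith) _ _ _
    rcases lt_or_ge (t - s) 0 with hs' | hs'
    · simp only [exponentialPDF_of_neg hs', zero_mul]
      rw [← mul_zero (exponentialPDF lam s), ← lintegral_zero (μ := stdGaussian (Vec d))]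
      congr 1
      exact lintegral_congr fun ξ => (jumpExp_of_neg hs' _ _ _).symm
    have e1 : ∀ ξ, jumpExp lam φ r 0 (t - (t - s)) f (r ξ (φ (t - s) y))
        = ENNReal.ofReal (Real.exp (-(lam * s))) * f (φ s (r ξ (φ (t - s) y))) := by
      intro ξ
      rw [sub_sub_cancel, jumpExp_zero hlam hφ hr hs hf]
    have e2 : ∀ ξ, jumpExp lam φ r 0 (t - s) (fun z => f (φ s (r ξ z))) y
        = ENNReal.ofReal (Real.exp (-(lam * (t - s)))) * f (φ s (r ξ (φ (t - s) y))) := by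
      intro ξ
      rw [jumpExp_zero hlam hφ hr hs' (f := fun z => f (φ s (r ξ z))) (hf.comp
        (hstep.comp (measurable_const (a := ((s, ξ) : ℝ × Vec d)).prodMk measurable_id)))]
    simp only [e1, e2]
    rw [lintegral_const_mul' _ _ ENNReal.ofReal_ne_top,
      lintegral_const_mul' _ _ ENNReal.ofReal_ne_top, exponentialPDF_of_nonneg hs,
      exponentialPDF_of_nonneg hs', ENNReal.ofReal_mul hlam.le, ENNReal.ofReal_mul hlam.le]
    ring
  | succ n ih =>
    rw [jumpExp_succ hφ hr (n + 1) t hf y]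
    have e1 : ∀ p : ℝ × Vec d, jumpExp lam φ r (n + 1) (t - p.1) f (r p.2 (φ p.1 y))
        = ∫⁻ q, jumpExp lam φ r n (t - p.1 - q.1) (fun z => f (φ q.1 (r q.2 z)))
            (r p.2 (φ p.1 y)) ∂(stepLaw d lam) := fun p =>
      ih _ _ (measurable_const.sub measurable_fst)
    have e2 : ∀ q : ℝ × Vec d,
        jumpExp lam φ r (n + 1) (t - q.1) (fun z => f (φ q.1 (r q.2 z))) y
        = ∫⁻ p, jumpExp lam φ r n (t - q.1 - p.1) (fun z => f (φ q.1 (r q.2 z)))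
            (r p.2 (φ p.1 y)) ∂(stepLaw d lam) := fun q =>
      jumpExp_succ hφ hr n _
        (hf.comp (hstep.comp (measurable_const (a := q).prodMk measurable_id))) y
    simp_rw [e1, e2]
    rw [lintegral_lintegral_swap]
    · refine lintegral_congr fun q => lintegral_congr fun p => ?_
      rw [sub_right_comm]
    · refine (measurable_jumpExp (A := (ℝ × Vec d) × (ℝ × Vec d)) hφ hr n
        (t := fun a => t - a.1.1 - a.2.1) ?_ (f := fun a z => f (φ a.2.1 (r a.2.2 z))) ?_
        (y := fun a => r a.1.2 (φ a.1.1 y)) ?_).aemeasurable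
      · fun_prop
      · exact hf.comp (hstep.comp (measurable_fst.snd.prodMk measurable_snd))
      · exact (hstep' y).comp measurable_fst

/-! ### The law of the process as a sum over the number of jumps -/

theorem measurable_refreshCount (t : ℝ) :
    Measurable fun ω : ℕ → ℝ × Vec d => refreshCount ω t := by
  classical
  refine measurable_to_nat fun ω => ?_
  set k := refreshCount ω t
  have hA : ∀ n, MeasurableSet {ω : ℕ → ℝ × Vec d | t < refreshTime ω (n + 1)} := fun n =>
    measurableSet_lt measurable_const (measurable_refreshTime (n + 1))
  have hall : MeasurableSet {ω : ℕ → ℝ × Vec d | ∀ n, ¬ t < refreshTime ω (n + 1)} := by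
    rw [Set.ofPred_forall]
    exact MeasurableSet.iInter fun n => (hA n).compl
  have hlt : MeasurableSet {ω : ℕ → ℝ × Vec d | ∀ n < k, ¬ t < refreshTime ω (n + 1)} := by
    simp_rw [Set.ofPred_forall]
    exact MeasurableSet.iInter fun n => MeasurableSet.iInter fun _ => (hA n).compl
  -- the count is the junk value `sInf ∅ = 0` when all refreshments occur up to time `t`
  have heq : (fun ω : ℕ → ℝ × Vec d => refreshCount ω t) ⁻¹' {k}
      = ({ω | t < refreshTime ω (k + 1)} ∩ {ω | ∀ n < k, ¬ t < refreshTime ω (n + 1)})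
        ∪ ({ω | ∀ n, ¬ t < refreshTime ω (n + 1)} ∩ {_ω | k = 0}) := by
    ext ω'
    simp only [Set.mem_preimage, Set.mem_singleton_iff, Set.mem_union, Set.mem_inter_iff,
      Set.mem_ofPred_eq]
    constructor
    · intro h
      by_cases hne : {n : ℕ | t < refreshTime ω' (n + 1)}.Nonempty
      · left
        rw [← h]
        exact ⟨Nat.sInf_mem hne, fun n hn => Nat.notMem_of_lt_sInf hn⟩
      · right
        rw [Set.not_nonempty_iff_eq_empty] at hne
        refine ⟨fun n hn => ?_, ?_⟩
        · exact absurd (show n ∈ {n : ℕ | t < refreshTime ω' (n + 1)} from hn) (by simp [hne])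
        · rw [← h, refreshCount, hne, Nat.sInf_empty]
    · rintro (⟨h1, h2⟩ | ⟨h1, h2⟩)
      · refine le_antisymm (Nat.sInf_le h1) ?_
        by_contra hlt
        exact h2 _ (not_le.1 hlt) (Nat.sInf_mem (s := {n : ℕ | t < refreshTime ω' (n + 1)})
          ⟨k, h1⟩)
      · rw [h2, refreshCount, Nat.sInf_eq_zero]
        right
        ext n
        simpa using h1 n
  rw [heq]
  exact ((hA k).inter hlt).union (hall.inter (MeasurableSet.const _))

theorem measurable_jumpPath (hφ : Measurable fun q : ℝ × Y => φ q.1 q.2)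
    (hr : Measurable fun q : Vec d × Y => r q.1 q.2) (t : ℝ) :
    Measurable fun q : Y × (ℕ → ℝ × Vec d) => jumpPath φ r q.1 t q.2 := by
  have h1 : Measurable fun a : ℕ × (Y × (ℕ → ℝ × Vec d)) =>
      φ (t - refreshTime a.2.2 a.1) (jumpSkeleton φ r a.2.2 a.2.1 a.1) := by
    refine measurable_from_prod_countable_right fun n => ?_
    exact hφ.comp (((measurable_const.sub ((measurable_refreshTime n).comp
      measurable_snd))).prodMk ((measurable_jumpSkeleton hφ hr n).comp
      (measurable_snd.prodMk measurable_fst)))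
  exact h1.comp (((measurable_refreshCount t).comp measurable_snd).prodMk measurable_id)

/-- The number of jumps up to time `t` is almost surely finite, so that expectations split into
the contributions of the events that exactly `n` jumps have occurred. -/
theorem lintegral_jumpPath (hlam : 0 < lam) [IsProbabilityMeasure (expMeasure lam)]
    (hφ : Measurable fun q : ℝ × Y => φ q.1 q.2)
    (hr : Measurable fun q : Vec d × Y => r q.1 q.2) {t : ℝ} (ht : 0 ≤ t)
    {f : Y → ℝ≥0∞} (hf : Measurable f) (y : Y) :
    ∫⁻ ω, f (jumpPath φ r y t ω) ∂(noise d lam) = ∑' n, jumpExp lam φ r n t f y := by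
  simp only [jumpExp]
  rw [← lintegral_tsum fun n => (measurable_jumpTerm_right hφ hr n t hf y).aemeasurable]
  refine lintegral_congr_ae ?_
  filter_upwards [ae_noise_nonneg, ae_exists_lt_refreshTime hlam t] with ω h0 hex
  set k := refreshCount ω t with hk
  have hmono : Monotone (refreshTime ω) := monotone_nat_of_le_succ fun n => by
    rw [refreshTime, refreshTime, Finset.sum_range_succ]
    linarith [h0 n]
  have hlt : t < refreshTime ω (k + 1) :=
    Nat.sInf_mem (s := {n : ℕ | t < refreshTime ω (n + 1)}) hex
  have hle : refreshTime ω k ≤ t := by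
    rcases Nat.eq_zero_or_pos k with h | h
    · rw [h]
      simpa [refreshTime] using ht
    · have h2 : k - 1 ∉ {n : ℕ | t < refreshTime ω (n + 1)} :=
        Nat.notMem_of_lt_sInf (show k - 1 < k by omega)
      simp only [Set.mem_ofPred_eq, not_lt] at h2
      rwa [Nat.sub_add_cancel h] at h2
  rw [tsum_eq_single k]
  · rw [jumpTerm, if_pos ⟨hle, hlt⟩]
    rfl
  · intro n hn
    rw [jumpTerm, if_neg]
    rintro ⟨ha, hb⟩
    rcases lt_or_gt_of_ne hn with h | h
    · exact absurd (hmono (show n + 1 ≤ k by omega)) (by linarith)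
    · exact absurd (hmono (show k + 1 ≤ n by omega)) (by linarith)

end

section

variable {d : ℕ}

/-! ### Linear Hamiltonian dynamics and the quadratic form of the contraction -/

theorem inner_act_comm {H : Matrix (Fin d) (Fin d) ℝ} (hH : H.IsHermitian) (u w : Vec d) :
    inner ℝ u (act H w) = inner ℝ (act H u) w :=
  ((Matrix.isSymmetric_toEuclideanLin_iff (𝕜 := ℝ) (A := H)).2 hH u w).symm

theorem inner_act_eq_dotProduct (H : Matrix (Fin d) (Fin d) ℝ) (u w : Vec d) :
    inner ℝ u (act H w) = dotProduct u.ofLp (H.mulVec w.ofLp) :=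
  Matrix.inner_toEuclideanCLM H u w

theorem isHermitian_of_posSemidef_sub {H : Matrix (Fin d) (Fin d) ℝ} {m : ℝ}
    (hmH : (H - m • (1 : Matrix (Fin d) (Fin d) ℝ)).PosSemidef) : H.IsHermitian := by
  have h1 : (m • (1 : Matrix (Fin d) (Fin d) ℝ)).IsHermitian := by
    simp [Matrix.IsHermitian]
  simpa using hmH.1.add h1

theorem le_inner_act {H : Matrix (Fin d) (Fin d) ℝ} {m : ℝ}
    (hmH : (H - m • (1 : Matrix (Fin d) (Fin d) ℝ)).PosSemidef) (x : Vec d) :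
    m * ‖x‖ ^ 2 ≤ inner ℝ x (act H x) := by
  have h := hmH.dotProduct_mulVec_nonneg x.ofLp
  have e : ‖x‖ ^ 2 = dotProduct x.ofLp x.ofLp := by
    rw [EuclideanSpace.real_norm_sq_eq, dotProduct]
    simp [sq]
  rw [inner_act_eq_dotProduct, e]
  simp only [Matrix.sub_mulVec, Matrix.smul_mulVec, Matrix.one_mulVec, dotProduct_sub,
    dotProduct_smul, smul_eq_mul, star_trivial] at h
  linarith

/-- The quadratic form `⟨x, H x⟩ + 2 β ⟨x, v⟩ + |v|²`. The part without the cross term is twice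
the energy, which the Hamiltonian flow preserves; the cross term produces dissipation in `x`. -/
noncomputable def crossEnergy (H : Matrix (Fin d) (Fin d) ℝ) (β : ℝ) (w : Phase d) : ℝ :=
  inner ℝ w.1 (act H w.1) + 2 * β * inner ℝ w.1 w.2 + ‖w.2‖ ^ 2

/-- The matrix of `crossEnergy H β`. -/
noncomputable def crossEnergyMatrix (H : Matrix (Fin d) (Fin d) ℝ) (β : ℝ) :
    Matrix (Fin d ⊕ Fin d) (Fin d ⊕ Fin d) ℝ :=
  Matrix.fromBlocks H (β • 1) (β • 1) 1

/-- The linear part of the refreshment, which damps the velocity. -/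
def damp (α : ℝ) (w : Phase d) : Phase d := (w.1, α • w.2)

/-- The velocity flip. -/
def flip (z : Phase d) : Phase d := (z.1, -z.2)

theorem dotProduct_crossEnergyMatrix (H : Matrix (Fin d) (Fin d) ℝ) (β : ℝ) (x v : Vec d) :
    dotProduct (Sum.elim x.ofLp v.ofLp) ((crossEnergyMatrix H β).mulVec (Sum.elim x.ofLp v.ofLp))
      = crossEnergy H β (x, v) := by
  have e1 : inner ℝ x v = dotProduct x.ofLp v.ofLp := by
    rw [EuclideanSpace.inner_eq_star_dotProduct, dotProduct_comm]; simp
  have e2 : ‖v‖ ^ 2 = dotProduct v.ofLp v.ofLp := by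
    rw [EuclideanSpace.real_norm_sq_eq, dotProduct]; simp [sq]
  rw [crossEnergyMatrix, Matrix.fromBlocks_mulVec, crossEnergy, inner_act_eq_dotProduct, e1, e2,
    sumElim_dotProduct_sumElim]
  simp only [Sum.elim_comp_inl, Sum.elim_comp_inr, Matrix.smul_mulVec, Matrix.one_mulVec,
    dotProduct_add, dotProduct_smul, smul_eq_mul, dotProduct_comm v.ofLp x.ofLp]
  ring

theorem sqDist_crossEnergyMatrix (H : Matrix (Fin d) (Fin d) ℝ) (β : ℝ) (p : Phase d × Phase d) :
    sqDist (crossEnergyMatrix H β) p = crossEnergy H β (p.2 - p.1) :=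
  dotProduct_crossEnergyMatrix H β (p.2.1 - p.1.1) (p.2.2 - p.1.2)

variable {H : Matrix (Fin d) (Fin d) ℝ} {m : ℝ}

/-- The cross term is dominated by the energy, as `H ≥ m`. -/
theorem abs_cross_le (hm : 0 < m) (hmH : (H - m • (1 : Matrix (Fin d) (Fin d) ℝ)).PosSemidef)
    (w : Phase d) :
    |2 * Real.sqrt m * inner ℝ w.1 w.2| ≤ inner ℝ w.1 (act H w.1) + ‖w.2‖ ^ 2 := by
  have h1 := le_inner_act hmH w.1
  have h2 := abs_real_inner_le_norm w.1 w.2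
  have hs := Real.sq_sqrt hm.le
  have h0 : 0 ≤ 2 * Real.sqrt m := by positivity
  rw [abs_mul, abs_of_nonneg h0]
  have h3 := mul_le_mul_of_nonneg_left h2 h0
  nlinarith [sq_nonneg (Real.sqrt m * ‖w.1‖ - ‖w.2‖)]

theorem le_crossEnergy (hm : 0 < m)
    (hmH : (H - m • (1 : Matrix (Fin d) (Fin d) ℝ)).PosSemidef) (w : Phase d) :
    3 / 4 * (m * ‖w.1‖ ^ 2 + ‖w.2‖ ^ 2) ≤ crossEnergy H (Real.sqrt m / 4) w := by
  have h1 := abs_le.1 (abs_cross_le hm hmH w)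
  have h2 := le_inner_act hmH w.1
  rw [crossEnergy]
  linarith [h1.1]

theorem crossEnergy_nonneg (hm : 0 < m)
    (hmH : (H - m • (1 : Matrix (Fin d) (Fin d) ℝ)).PosSemidef) (w : Phase d) :
    0 ≤ crossEnergy H (Real.sqrt m / 4) w :=
  le_trans (by positivity) (le_crossEnergy hm hmH w)

theorem crossEnergy_flip_le (hm : 0 < m)
    (hmH : (H - m • (1 : Matrix (Fin d) (Fin d) ℝ)).PosSemidef) (w : Phase d) :
    crossEnergy H (Real.sqrt m / 4) (flip w) ≤ 5 / 3 * crossEnergy H (Real.sqrt m / 4) w := by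
  have h1 := abs_le.1 (abs_cross_le hm hmH w)
  simp only [crossEnergy, flip, inner_neg_right, norm_neg]
  linarith [h1.1]

theorem posDef_crossEnergyMatrix (hm : 0 < m)
    (hmH : (H - m • (1 : Matrix (Fin d) (Fin d) ℝ)).PosSemidef) :
    (crossEnergyMatrix H (Real.sqrt m / 4)).PosDef := by
  refine Matrix.PosDef.of_dotProduct_mulVec_pos ?_ fun w hw => ?_
  · have hH := isHermitian_of_posSemidef_sub hmH
    rw [crossEnergyMatrix]
    refine Matrix.IsHermitian.fromBlocks hH ?_ Matrix.isHermitian_one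
    simp
  · set x : Vec d := WithLp.toLp 2 (w ∘ Sum.inl) with hx
    set v : Vec d := WithLp.toLp 2 (w ∘ Sum.inr) with hv
    have e : w = Sum.elim x.ofLp v.ofLp := (Sum.elim_comp_inl_inr w).symm
    rw [star_trivial, e, dotProduct_crossEnergyMatrix]
    refine lt_of_lt_of_le ?_ (le_crossEnergy hm hmH (x, v))
    by_contra hle
    have hx0 : ‖x‖ ^ 2 = 0 := by nlinarith [sq_nonneg ‖x‖, sq_nonneg ‖v‖]
    have hv0 : ‖v‖ ^ 2 = 0 := by nlinarith [sq_nonneg ‖x‖, sq_nonneg ‖v‖]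
    have hx1 : x = 0 := by simpa using hx0
    have hv1 : v = 0 := by simpa using hv0
    refine hw ?_
    rw [e, hx1, hv1]
    ext i
    cases i <;> simp

/-- The derivative of `crossEnergy H β`. -/
noncomputable def crossEnergyDeriv (H : Matrix (Fin d) (Fin d) ℝ) (β : ℝ) (w : Phase d) :
    Phase d →L[ℝ] ℝ :=
  ((2 : ℝ) • (innerSL ℝ (act H w.1)) + (2 * β) • innerSL ℝ w.2).comp
      (ContinuousLinearMap.fst ℝ (Vec d) (Vec d))
    + ((2 * β) • innerSL ℝ w.1 + (2 : ℝ) • innerSL ℝ w.2).comp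
      (ContinuousLinearMap.snd ℝ (Vec d) (Vec d))

theorem crossEnergyDeriv_apply (H : Matrix (Fin d) (Fin d) ℝ) (β : ℝ) (w h : Phase d) :
    crossEnergyDeriv H β w h = 2 * inner ℝ (act H w.1) h.1 + 2 * β * inner ℝ w.2 h.1
      + (2 * β * inner ℝ w.1 h.2 + 2 * inner ℝ w.2 h.2) := by
  simp [crossEnergyDeriv]

theorem hasFDerivAt_crossEnergy (hH : H.IsHermitian) (β : ℝ) (w : Phase d) :
    HasFDerivAt (crossEnergy H β) (crossEnergyDeriv H β w) w := by
  have hfst : HasFDerivAt (fun w : Phase d => w.1) (ContinuousLinearMap.fst ℝ (Vec d) (Vec d)) w :=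
    hasFDerivAt_fst
  have hsnd : HasFDerivAt (fun w : Phase d => w.2) (ContinuousLinearMap.snd ℝ (Vec d) (Vec d)) w :=
    hasFDerivAt_snd
  have h1 := hfst.inner ℝ ((act H).hasFDerivAt.comp w hfst)
  have h2 := (hfst.inner ℝ hsnd).const_mul (2 * β)
  have h3 := hsnd.norm_sq
  refine ((h1.add h2).add h3).congr_fderiv ?_
  refine ContinuousLinearMap.ext fun h => ?_
  rw [crossEnergyDeriv_apply]
  simp only [add_apply, smul_apply,
    ContinuousLinearMap.comp_apply, ContinuousLinearMap.prod_apply, fderivInnerCLM_apply,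
    ContinuousLinearMap.coe_fst', ContinuousLinearMap.coe_snd', innerSL_apply_apply, smul_eq_mul,
    Function.comp_apply, inner_act_comm hH]
  rw [← inner_act_comm hH h.1 w.1, real_inner_comm (act H w.1) h.1, real_inner_comm w.2 h.1,
    nsmul_eq_mul]
  push_cast
  ring

theorem continuous_crossEnergy (H : Matrix (Fin d) (Fin d) ℝ) (β : ℝ) :
    Continuous (crossEnergy H β) := by
  unfold crossEnergy
  fun_prop

theorem fieldCLM_apply (H : Matrix (Fin d) (Fin d) ℝ) (w : Phase d) :
    fieldCLM H w = (w.2, -act H w.1) := rfl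

/-- The infinitesimal contraction: in the direction of the linear Hamiltonian field the energy
terms cancel, and what remains is a negative definite form in `(√m x, v)`. -/
theorem crossEnergyDeriv_fieldCLM_add_le (hm : 0 < m)
    (hmH : (H - m • (1 : Matrix (Fin d) (Fin d) ℝ)).PosSemidef) {α lam μ : ℝ} (hα0 : 0 ≤ α)
    (hα1 : α < 1) (hlam : lam = 2 * Real.sqrt m / (1 - α)) (hμ : μ = Real.sqrt m / 3)
    (w : Phase d) :
    crossEnergyDeriv H (Real.sqrt m / 4) w (fieldCLM H w)
        + lam * (crossEnergy H (Real.sqrt m / 4) (damp α w) - crossEnergy H (Real.sqrt m / 4) w)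
      ≤ -μ * crossEnergy H (Real.sqrt m / 4) w := by
  have hH := isHermitian_of_posSemidef_sub hmH
  have hla : lam * (1 - α) = 2 * Real.sqrt m := by
    rw [hlam, div_mul_cancel₀]; linarith
  set s := Real.sqrt m with hs
  have hs0 : 0 < s := Real.sqrt_pos.2 hm
  have hs2 : s ^ 2 = m := Real.sq_sqrt hm.le
  have h1 := le_inner_act hmH w.1
  have h2 := abs_le.1 (abs_real_inner_le_norm w.1 w.2)
  have e1 : inner ℝ (act H w.1) w.2 = inner ℝ w.2 (act H w.1) := real_inner_comm _ _
  have e2 : inner ℝ w.2 w.2 = ‖w.2‖ ^ 2 := real_inner_self_eq_norm_sq _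
  have e3 : lam * (crossEnergy H (s / 4) (damp α w) - crossEnergy H (s / 4) w)
      = -(2 * s) * (s / 2 * inner ℝ w.1 w.2 + (1 + α) * ‖w.2‖ ^ 2) := by
    rw [← hla]
    simp only [crossEnergy, damp, inner_smul_right, norm_smul, mul_pow, Real.norm_eq_abs, sq_abs]
    ring
  rw [e3, crossEnergyDeriv_apply, fieldCLM_apply, hμ, crossEnergy]
  simp only [inner_neg_right]
  rw [e1, e2]
  -- Cauchy-Schwarz reduces the claim to a binary quadratic form in `√m |x|` and `|v|`
  have key : 0 ≤ inner ℝ w.1 (act H w.1) / 6 + 5 / 6 * (s * inner ℝ w.1 w.2)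
      + 7 / 6 * ‖w.2‖ ^ 2 := by
    have h3 : -(s * (‖w.1‖ * ‖w.2‖)) ≤ s * inner ℝ w.1 w.2 := by nlinarith [h2.1]
    nlinarith [sq_nonneg (s * ‖w.1‖ - 5 / 2 * ‖w.2‖), sq_nonneg ‖w.2‖]
  have hv : 0 ≤ α * ‖w.2‖ ^ 2 := by positivity
  nlinarith [mul_nonneg hs0.le key, mul_nonneg hs0.le hv]

/-! ### The coupled generator -/

theorem refresh_sub_refresh (α : ℝ) (ξ : Vec d) (z₁ z₂ : Phase d) :
    refresh α ξ z₂ - refresh α ξ z₁ = damp α (z₂ - z₁) := by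
  ext1
  · rfl
  · simp [refresh, damp, smul_sub]

theorem hamiltonianField_sub (hH : H.IsHermitian) (c : Vec d) (z₁ z₂ : Phase d) :
    hamiltonianField (gaussianPotential H c) z₂ - hamiltonianField (gaussianPotential H c) z₁
      = fieldCLM H (z₂ - z₁) := by
  ext1
  · rfl
  · simp [hamiltonianField, (hasGradientAt_gaussianPotential hH c _).gradient, fieldCLM]

theorem coupledGenerator_sqDist (hH : H.IsHermitian) (c : Vec d) (α lam β : ℝ)
    (p : Phase d × Phase d) :
    coupledGenerator (gaussianPotential H c) α lam (sqDist (crossEnergyMatrix H β)) p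
      = crossEnergyDeriv H β (p.2 - p.1) (fieldCLM H (p.2 - p.1))
        + lam * (crossEnergy H β (damp α (p.2 - p.1)) - crossEnergy H β (p.2 - p.1)) := by
  have hF : sqDist (crossEnergyMatrix H β) = fun p => crossEnergy H β (p.2 - p.1) :=
    funext (sqDist_crossEnergyMatrix H β)
  have hd : HasFDerivAt (fun p : Phase d × Phase d => p.2 - p.1)
      (ContinuousLinearMap.snd ℝ (Phase d) (Phase d)
        - ContinuousLinearMap.fst ℝ (Phase d) (Phase d)) p :=
    hasFDerivAt_snd.sub hasFDerivAt_fst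
  have h := (hasFDerivAt_crossEnergy hH β (p.2 - p.1)).comp p hd
  rw [coupledGenerator, hF]
  have h' : fderiv ℝ (fun p : Phase d × Phase d => crossEnergy H β (p.2 - p.1)) p = _ := h.fderiv
  rw [h']
  simp only [refresh_sub_refresh, integral_const, probReal_univ, one_smul,
    ContinuousLinearMap.comp_apply]
  congr 2
  exact hamiltonianField_sub hH c p.1 p.2

/-! ### The flow -/

theorem continuous_flowCLM (H : Matrix (Fin d) (Fin d) ℝ) :
    Continuous fun t : ℝ => NormedSpace.exp (t • fieldCLM H) :=
  continuous_iff_continuousAt.2 fun t =>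
    (hasDerivAt_exp_smul_const (𝕂 := ℝ) (fieldCLM H) t).continuousAt

theorem measurable_flow (H : Matrix (Fin d) (Fin d) ℝ) (c : Vec d) :
    Measurable fun q : ℝ × Phase d => flow H c q.1 q.2 := by
  refine Continuous.measurable ?_
  unfold flow
  exact continuous_const.add (((continuous_flowCLM H).comp continuous_fst).clm_apply
    (continuous_snd.sub continuous_const))

theorem measurable_refresh (α : ℝ) :
    Measurable fun q : Vec d × Phase d => refresh α q.1 q.2 := by
  refine Continuous.measurable ?_
  unfold refresh
  fun_prop

theorem flow_sub_flow (H : Matrix (Fin d) (Fin d) ℝ) (c : Vec d) (t : ℝ) (z₁ z₂ : Phase d) :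
    flow H c t z₂ - flow H c t z₁ = NormedSpace.exp (t • fieldCLM H) (z₂ - z₁) := by
  simp only [flow, map_sub]
  abel

theorem hasDerivAt_exp_smul_apply (K : Phase d →L[ℝ] Phase d) (w : Phase d) (t : ℝ) :
    HasDerivAt (fun s : ℝ => NormedSpace.exp (s • K) w) (K (NormedSpace.exp (t • K) w)) t := by
  have h := (hasDerivAt_exp_smul_const' (𝕂 := ℝ) K t).clm_apply (hasDerivAt_const t w)
  simpa using h

theorem exp_zero_smul_apply (K : Phase d →L[ℝ] Phase d) (w : Phase d) :
    NormedSpace.exp ((0 : ℝ) • K) w = w := by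
  have h : (0 : ℝ) • K = 0 := by ext <;> simp
  simp [h, NormedSpace.exp_zero]

end

/-! ### Exponential decay of the expected squared distance -/

section

variable {d : ℕ}

/-- A Lyapunov bound that is preserved by one step of the first-jump decomposition holds for the
process killed at its `n`-th jump, for every `n`. -/
theorem sum_jumpExp_le {Y : Type*} [MeasurableSpace Y] {lam : ℝ} (hlam : 0 < lam)
    [IsProbabilityMeasure (expMeasure lam)] {φ : ℝ → Y → Y} {r : Vec d → Y → Y}
    (hφ : Measurable fun q : ℝ × Y => φ q.1 q.2)
    (hr : Measurable fun q : Vec d × Y => r q.1 q.2) {F : Y → ℝ≥0∞} (hF : Measurable F)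
    {b : ℝ → ℝ≥0∞}
    (hstep : ∀ t, 0 ≤ t → ∀ y, ENNReal.ofReal (Real.exp (-(lam * t))) * F (φ t y)
      + ∫⁻ p, (Set.Iic t).indicator (fun s => b (t - s) * F (r p.2 (φ s y))) p.1 ∂(stepLaw d lam)
        ≤ b t * F y)
    (n : ℕ) {t : ℝ} (ht : 0 ≤ t) (y : Y) :
    ∑ k ∈ Finset.range n, jumpExp lam φ r k t F y ≤ b t * F y := by
  induction n generalizing t y with
  | zero => simp
  | succ n ih =>
    rw [Finset.sum_range_succ', jumpExp_zero hlam hφ hr ht hF, add_comm]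
    refine le_trans ?_ (hstep t ht y)
    gcongr
    simp_rw [jumpExp_succ hφ hr _ t hF y]
    rw [← lintegral_finsetSum]
    · refine lintegral_mono fun p => ?_
      by_cases hp : p.1 ≤ t
      · rw [Set.indicator_of_mem (show p.1 ∈ Set.Iic t from hp)]
        exact ih (sub_nonneg.2 hp) _
      · rw [Finset.sum_eq_zero]
        · exact zero_le
        · intro k _
          exact jumpExp_of_neg (by linarith) _ _ _
    · intro k _
      exact measurable_jumpExp hφ hr k (measurable_const.sub measurable_fst)
        (hF.comp measurable_snd)
        (hr.comp (measurable_snd.prodMk (hφ.comp (measurable_fst.prodMk measurable_const))))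

/-- Two copies of `φ`, run side by side. -/
def pairFlow {Y : Type*} (φ : ℝ → Y → Y) (t : ℝ) (p : Y × Y) : Y × Y := (φ t p.1, φ t p.2)

/-- Two copies of `r`, driven by the same normal vector. -/
def pairJump {Y : Type*} (r : Vec d → Y → Y) (ξ : Vec d) (p : Y × Y) : Y × Y :=
  (r ξ p.1, r ξ p.2)

theorem measurable_pairFlow {Y : Type*} [MeasurableSpace Y] {φ : ℝ → Y → Y}
    (hφ : Measurable fun q : ℝ × Y => φ q.1 q.2) :
    Measurable fun q : ℝ × (Y × Y) => pairFlow φ q.1 q.2 :=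
  (hφ.comp (measurable_fst.prodMk measurable_snd.fst)).prodMk
    (hφ.comp (measurable_fst.prodMk measurable_snd.snd))

theorem measurable_pairJump {Y : Type*} [MeasurableSpace Y] {r : Vec d → Y → Y}
    (hr : Measurable fun q : Vec d × Y => r q.1 q.2) :
    Measurable fun q : Vec d × (Y × Y) => pairJump r q.1 q.2 :=
  (hr.comp (measurable_fst.prodMk measurable_snd.fst)).prodMk
    (hr.comp (measurable_fst.prodMk measurable_snd.snd))

theorem jumpSkeleton_pair {Y : Type*} (φ : ℝ → Y → Y) (r : Vec d → Y → Y)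
    (ω : ℕ → ℝ × Vec d) (p : Y × Y) (n : ℕ) :
    jumpSkeleton (pairFlow φ) (pairJump r) ω p n
      = (jumpSkeleton φ r ω p.1 n, jumpSkeleton φ r ω p.2 n) := by
  induction n with
  | zero => rfl
  | succ n ih =>
    rw [jumpSkeleton, ih]
    rfl

theorem skeleton_eq_jumpSkeleton (H : Matrix (Fin d) (Fin d) ℝ) (c : Vec d) (α : ℝ)
    (ω : ℕ → ℝ × Vec d) (z : Phase d) (n : ℕ) :
    skeleton H c α ω z n = jumpSkeleton (flow H c) (refresh α) ω z n := by
  induction n with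
  | zero => rfl
  | succ n ih => rw [skeleton, ih, jumpSkeleton]

theorem path_eq_jumpPath (H : Matrix (Fin d) (Fin d) ℝ) (c : Vec d) (α : ℝ)
    (z : Phase d) (t : ℝ) (ω : ℕ → ℝ × Vec d) :
    path H c α z t ω = jumpPath (flow H c) (refresh α) z t ω := by
  rw [path, skeleton_eq_jumpSkeleton, jumpPath]

theorem measurable_path (H : Matrix (Fin d) (Fin d) ℝ) (c : Vec d) (α t : ℝ) :
    Measurable fun q : Phase d × (ℕ → ℝ × Vec d) => path H c α q.1 t q.2 := by
  simp_rw [path_eq_jumpPath]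
  exact measurable_jumpPath (measurable_flow H c) (measurable_refresh α) t

theorem measurable_path_right (H : Matrix (Fin d) (Fin d) ℝ) (c : Vec d) (α : ℝ) (z : Phase d)
    (t : ℝ) : Measurable fun ω => path H c α z t ω := by
  have h := (measurable_path H c α t).comp (measurable_prodMk_left (x := z))
  exact h

theorem path_pair (H : Matrix (Fin d) (Fin d) ℝ) (c : Vec d) (α : ℝ)
    (p : Phase d × Phase d) (t : ℝ) (ω : ℕ → ℝ × Vec d) :
    jumpPath (pairFlow (flow H c)) (pairJump (refresh α)) p t ω
      = (path H c α p.1 t ω, path H c α p.2 t ω) := by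
  rw [path_eq_jumpPath, path_eq_jumpPath, jumpPath, jumpSkeleton_pair]
  rfl

variable {H : Matrix (Fin d) (Fin d) ℝ} {m : ℝ}

/-- Duhamel's formula turns the infinitesimal contraction into the one-step inequality of the
first-jump decomposition: `s ↦ exp (-lam s - μ (t - s)) E(w_s)` decreases at least at the rate at
which jumps carry the quantity away. -/
theorem crossEnergy_duhamel_le (hm : 0 < m)
    (hmH : (H - m • (1 : Matrix (Fin d) (Fin d) ℝ)).PosSemidef) {α lam μ : ℝ} (hα0 : 0 ≤ α)
    (hα1 : α < 1) (hlam : lam = 2 * Real.sqrt m / (1 - α)) (hμ : μ = Real.sqrt m / 3)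
    (w : Phase d) {t : ℝ} (ht : 0 ≤ t) :
    Real.exp (-(lam * t)) * crossEnergy H (Real.sqrt m / 4) (NormedSpace.exp (t • fieldCLM H) w)
      + ∫ s in (0 : ℝ)..t, lam * Real.exp (-(lam * s)) * (Real.exp (-μ * (t - s))
        * crossEnergy H (Real.sqrt m / 4) (damp α (NormedSpace.exp (s • fieldCLM H) w)))
      ≤ Real.exp (-μ * t) * crossEnergy H (Real.sqrt m / 4) w := by
  have hH := isHermitian_of_posSemidef_sub hmH
  set β := Real.sqrt m / 4 with hβ
  set A : ℝ → Phase d := fun s => NormedSpace.exp (s • fieldCLM H) w with hA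
  have hAc : Continuous A := (continuous_flowCLM H).clm_apply continuous_const
  set e : ℝ → ℝ := fun s => Real.exp (-(lam * s)) * Real.exp (-μ * (t - s)) with he
  have hec : Continuous e := by fun_prop
  have hed : ∀ s, HasDerivAt e ((μ - lam) * e s) s := by
    intro s
    have h1 : HasDerivAt (fun s => Real.exp (-(lam * s)))
        (Real.exp (-(lam * s)) * -(lam * 1)) s :=
      (((hasDerivAt_id s).const_mul lam).neg).exp
    have h2 : HasDerivAt (fun s => Real.exp (-μ * (t - s)))
        (Real.exp (-μ * (t - s)) * (-μ * -1)) s :=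
      ((((hasDerivAt_id s).const_sub t)).const_mul (-μ)).exp
    refine (h1.mul h2).congr_deriv ?_
    simp only [he]
    ring
  have hAd : ∀ s, HasDerivAt (fun s => crossEnergy H β (A s))
      (crossEnergyDeriv H β (A s) (fieldCLM H (A s))) s := fun s =>
    (hasFDerivAt_crossEnergy hH β (A s)).comp_hasDerivAt s
      (hasDerivAt_exp_smul_apply (fieldCLM H) w s)
  set G' : ℝ → ℝ := fun s => (μ - lam) * e s * crossEnergy H β (A s)
    + e s * crossEnergyDeriv H β (A s) (fieldCLM H (A s)) with hG'
  have hG'c : Continuous G' := by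
    have h1 : Continuous fun s => crossEnergyDeriv H β (A s) (fieldCLM H (A s)) := by
      simp only [crossEnergyDeriv_apply]
      fun_prop
    have h2 : Continuous fun s => crossEnergy H β (A s) := (continuous_crossEnergy H β).comp hAc
    fun_prop
  have hG : ∫ s in (0 : ℝ)..t, G' s
      = e t * crossEnergy H β (A t) - e 0 * crossEnergy H β (A 0) :=
    intervalIntegral.integral_eq_sub_of_hasDerivAt (fun s _ => (hed s).mul (hAd s))
      (hG'c.intervalIntegrable _ _)
  have hdc : Continuous fun s => crossEnergy H β (damp α (A s)) := by
    refine (continuous_crossEnergy H β).comp ?_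
    unfold damp
    fun_prop
  have hle : ∫ s in (0 : ℝ)..t, lam * e s * crossEnergy H β (damp α (A s))
      ≤ ∫ s in (0 : ℝ)..t, -G' s := by
    refine intervalIntegral.integral_mono_on ht ?_ ?_ fun s _ => ?_
    · exact Continuous.intervalIntegrable (by fun_prop) _ _
    · exact hG'c.neg.intervalIntegrable _ _
    · have h := crossEnergyDeriv_fieldCLM_add_le hm hmH hα0 hα1 hlam hμ (A s)
      have he0 : 0 ≤ e s := by positivity
      have h' := mul_le_mul_of_nonneg_left h he0
      simp only [hG']
      nlinarith
  have hcongr : ∫ s in (0 : ℝ)..t, lam * Real.exp (-(lam * s)) * (Real.exp (-μ * (t - s))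
        * crossEnergy H β (damp α (A s)))
      = ∫ s in (0 : ℝ)..t, lam * e s * crossEnergy H β (damp α (A s)) := by
    refine intervalIntegral.integral_congr fun s _ => ?_
    simp only [he]
    ring
  have e0 : e 0 = Real.exp (-μ * t) := by simp [he]
  have et : e t = Real.exp (-(lam * t)) := by simp [he]
  have A0 : A 0 = w := exp_zero_smul_apply _ _
  rw [hcongr]
  rw [intervalIntegral.integral_neg, hG, e0, et, A0] at hle
  linarith

/-- Integrating a function of the waiting time, up to time `t`, against the law of one step. -/
theorem lintegral_stepLaw_indicator {lam : ℝ} (hlam : 0 < lam) {t : ℝ} (ht : 0 ≤ t) {k : ℝ → ℝ}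
    (hk : Continuous k) (hk0 : ∀ s, 0 ≤ k s) :
    ∫⁻ q, (Set.Iic t).indicator (fun s => ENNReal.ofReal (k s)) q.1 ∂(stepLaw d lam)
      = ENNReal.ofReal (∫ s in (0 : ℝ)..t, lam * Real.exp (-(lam * s)) * k s) := by
  have hmeas : Measurable ((Set.Iic t).indicator fun s => ENNReal.ofReal (k s)) :=
    hk.measurable.ennreal_ofReal.indicator measurableSet_Iic
  rw [lintegral_stepLaw (g := fun q => (Set.Iic t).indicator (fun s => ENNReal.ofReal (k s)) q.1)
    (hmeas.comp measurable_fst)]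
  simp only [lintegral_const, measure_univ, mul_one]
  have hc : Continuous fun s => lam * Real.exp (-(lam * s)) * k s := by fun_prop
  rw [intervalIntegral.integral_of_le ht, ← integral_Icc_eq_integral_Ioc,
    ofReal_integral_eq_lintegral_ofReal hc.integrableOn_Icc
      (Filter.Eventually.of_forall fun s => mul_nonneg (by positivity) (hk0 s)),
    ← lintegral_indicator measurableSet_Icc]
  refine lintegral_congr fun s => ?_
  by_cases h0 : 0 ≤ s
  · by_cases h1 : s ≤ t
    · rw [Set.indicator_of_mem (show s ∈ Set.Iic t from h1),
        Set.indicator_of_mem (show s ∈ Set.Icc 0 t from ⟨h0, h1⟩),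
        exponentialPDF_of_nonneg h0, ← ENNReal.ofReal_mul (by positivity)]
    · rw [Set.indicator_of_notMem (show s ∉ Set.Iic t from h1),
        Set.indicator_of_notMem (show s ∉ Set.Icc 0 t from fun h => h1 h.2), mul_zero]
  · rw [exponentialPDF_of_neg (not_le.1 h0), zero_mul,
      Set.indicator_of_notMem (show s ∉ Set.Icc 0 t from fun h => h0 h.1)]

theorem pos_rate (hm : 0 < m) {α lam : ℝ} (hα1 : α < 1)
    (hlam : lam = 2 * Real.sqrt m / (1 - α)) : 0 < lam := by
  rw [hlam]
  exact div_pos (mul_pos two_pos (Real.sqrt_pos.2 hm)) (by linarith)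

/-- The one-step inequality for the expected squared distance of the coupled pair. -/
theorem crossEnergy_step_le (hm : 0 < m)
    (hmH : (H - m • (1 : Matrix (Fin d) (Fin d) ℝ)).PosSemidef) (c : Vec d) {α lam μ : ℝ}
    (hα0 : 0 ≤ α) (hα1 : α < 1) (hlam : lam = 2 * Real.sqrt m / (1 - α))
    (hμ : μ = Real.sqrt m / 3) {F : Phase d × Phase d → ℝ≥0∞}
    (hF : ∀ p, F p = ENNReal.ofReal (crossEnergy H (Real.sqrt m / 4) (p.2 - p.1)))
    {t : ℝ} (ht : 0 ≤ t) (p : Phase d × Phase d) :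
    ENNReal.ofReal (Real.exp (-(lam * t))) * F (pairFlow (flow H c) t p)
      + ∫⁻ q, (Set.Iic t).indicator (fun s => ENNReal.ofReal (Real.exp (-μ * (t - s)))
          * F (pairJump (refresh α) q.2 (pairFlow (flow H c) s p))) q.1 ∂(stepLaw d lam)
        ≤ ENNReal.ofReal (Real.exp (-μ * t)) * F p := by
  have hlam0 := pos_rate hm hα1 hlam
  obtain ⟨w, hw⟩ : ∃ w, w = p.2 - p.1 := ⟨_, rfl⟩
  have hgc : Continuous fun s : ℝ => crossEnergy H (Real.sqrt m / 4)
      (damp α (NormedSpace.exp (s • fieldCLM H) w)) := by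
    refine (continuous_crossEnergy H _).comp ?_
    have := (continuous_flowCLM H).clm_apply (continuous_const (y := w))
    unfold damp
    fun_prop
  have e1 : F (pairFlow (flow H c) t p) = ENNReal.ofReal
      (crossEnergy H (Real.sqrt m / 4) (NormedSpace.exp (t • fieldCLM H) w)) := by
    rw [hF, pairFlow, flow_sub_flow, hw]
  have e2 : ∀ (s : ℝ) (ξ : Vec d), ENNReal.ofReal (Real.exp (-μ * (t - s)))
      * F (pairJump (refresh α) ξ (pairFlow (flow H c) s p))
      = ENNReal.ofReal (Real.exp (-μ * (t - s)) * crossEnergy H (Real.sqrt m / 4)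
          (damp α (NormedSpace.exp (s • fieldCLM H) w))) := by
    intro s ξ
    rw [hF, pairJump, pairFlow, refresh_sub_refresh, flow_sub_flow, hw,
      ENNReal.ofReal_mul (Real.exp_nonneg _)]
  have hk0 : ∀ s : ℝ, 0 ≤ Real.exp (-μ * (t - s)) * crossEnergy H (Real.sqrt m / 4)
      (damp α (NormedSpace.exp (s • fieldCLM H) w)) := fun s =>
    mul_nonneg (Real.exp_nonneg _) (crossEnergy_nonneg hm hmH _)
  simp only [e1, e2]
  rw [lintegral_stepLaw_indicator hlam0 ht (by fun_prop) hk0, hF, ← hw,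
    ← ENNReal.ofReal_mul (Real.exp_nonneg _), ← ENNReal.ofReal_mul (Real.exp_nonneg _),
    ← ENNReal.ofReal_add (mul_nonneg (Real.exp_nonneg _) (crossEnergy_nonneg hm hmH _))
      (intervalIntegral.integral_nonneg ht fun s _ => mul_nonneg (by positivity) (hk0 s))]
  exact ENNReal.ofReal_le_ofReal (crossEnergy_duhamel_le hm hmH hα0 hα1 hlam hμ w ht)

theorem lintegral_crossEnergy_path_le (hm : 0 < m)
    (hmH : (H - m • (1 : Matrix (Fin d) (Fin d) ℝ)).PosSemidef) (c : Vec d) {α lam μ : ℝ}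
    (hα0 : 0 ≤ α) (hα1 : α < 1) (hlam : lam = 2 * Real.sqrt m / (1 - α))
    (hμ : μ = Real.sqrt m / 3) (z₁ z₂ : Phase d) {t : ℝ} (ht : 0 ≤ t) :
    ∫⁻ ω, ENNReal.ofReal (crossEnergy H (Real.sqrt m / 4)
        (path H c α z₂ t ω - path H c α z₁ t ω)) ∂(noise d lam)
      ≤ ENNReal.ofReal (Real.exp (-μ * t) * crossEnergy H (Real.sqrt m / 4) (z₂ - z₁)) := by
  have hlam0 := pos_rate hm hα1 hlam
  have := isProbabilityMeasure_expMeasure hlam0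
  obtain ⟨F, hFdef⟩ : ∃ F : Phase d × Phase d → ℝ≥0∞, ∀ p, F p = ENNReal.ofReal
    (crossEnergy H (Real.sqrt m / 4) (p.2 - p.1)) := ⟨_, fun _ => rfl⟩
  have hF : Measurable F := by
    rw [funext hFdef]
    exact ((continuous_crossEnergy H _).comp
      (continuous_snd.sub continuous_fst)).measurable.ennreal_ofReal
  have hφ := measurable_pairFlow (measurable_flow H c)
  have hr := measurable_pairJump (measurable_refresh (d := d) α)
  have h := lintegral_jumpPath hlam0 hφ hr ht hF (z₁, z₂)
  simp only [path_pair, hFdef] at h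
  rw [h, ENNReal.ofReal_mul (Real.exp_nonneg _)]
  refine ENNReal.tsum_le_of_sum_range_le fun n => ?_
  have h2 := sum_jumpExp_le hlam0 hφ hr hF (b := fun t => ENNReal.ofReal (Real.exp (-μ * t)))
    (fun t ht p => crossEnergy_step_le hm hmH c hα0 hα1 hlam hμ hFdef ht p) n ht (z₁, z₂)
  rw [hFdef] at h2
  exact h2

theorem measurable_crossEnergy_path_sub (H : Matrix (Fin d) (Fin d) ℝ) (β : ℝ) (c : Vec d)
    (α t : ℝ) (z₁ z₂ : Phase d) :
    Measurable fun ω => crossEnergy H β (path H c α z₂ t ω - path H c α z₁ t ω) := by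
  have h : Measurable fun ω => path H c α z₂ t ω - path H c α z₁ t ω :=
    (measurable_path_right H c α z₂ t).sub (measurable_path_right H c α z₁ t)
  exact (continuous_crossEnergy H β).measurable.comp h

theorem integrable_crossEnergy_path (hm : 0 < m)
    (hmH : (H - m • (1 : Matrix (Fin d) (Fin d) ℝ)).PosSemidef) (c : Vec d) {α lam : ℝ}
    (hα0 : 0 ≤ α) (hα1 : α < 1) (hlam : lam = 2 * Real.sqrt m / (1 - α))
    (z₁ z₂ : Phase d) {t : ℝ} (ht : 0 ≤ t) :
    Integrable (fun ω => crossEnergy H (Real.sqrt m / 4)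
        (path H c α z₂ t ω - path H c α z₁ t ω)) (noise d lam) := by
  refine ⟨(measurable_crossEnergy_path_sub H _ c α t z₁ z₂).aestronglyMeasurable, ?_⟩
  rw [hasFiniteIntegral_iff_ofReal (Filter.Eventually.of_forall fun ω =>
    crossEnergy_nonneg hm hmH _)]
  exact (lintegral_crossEnergy_path_le hm hmH c hα0 hα1 hlam rfl z₁ z₂ ht).trans_lt
    ENNReal.ofReal_lt_top

theorem integral_crossEnergy_path_le (hm : 0 < m)
    (hmH : (H - m • (1 : Matrix (Fin d) (Fin d) ℝ)).PosSemidef) (c : Vec d) {α lam μ : ℝ}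
    (hα0 : 0 ≤ α) (hα1 : α < 1) (hlam : lam = 2 * Real.sqrt m / (1 - α))
    (hμ : μ = Real.sqrt m / 3) (z₁ z₂ : Phase d) {t : ℝ} (ht : 0 ≤ t) :
    ∫ ω, crossEnergy H (Real.sqrt m / 4)
        (path H c α z₂ t ω - path H c α z₁ t ω) ∂(noise d lam)
      ≤ Real.exp (-μ * t) * crossEnergy H (Real.sqrt m / 4) (z₂ - z₁) := by
  rw [integral_eq_lintegral_of_nonneg_ae
    (Filter.Eventually.of_forall fun ω => crossEnergy_nonneg hm hmH _)
    (measurable_crossEnergy_path_sub H _ c α t z₁ z₂).aestronglyMeasurable]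
  refine ENNReal.toReal_le_of_le_ofReal ?_
    (lintegral_crossEnergy_path_le hm hmH c hα0 hα1 hlam hμ z₁ z₂ ht)
  exact mul_nonneg (Real.exp_nonneg _) (crossEnergy_nonneg hm hmH _)

end

/-! ### Symmetries of the Hamiltonian flow -/

section

variable {d : ℕ}

theorem flow_neg_flow (H : Matrix (Fin d) (Fin d) ℝ) (c : Vec d) (t : ℝ) (z : Phase d) :
    flow H c (-t) (flow H c t z) = z := by
  let _ := NormedAlgebra.restrictScalars ℚ ℝ (Phase d →L[ℝ] Phase d)
  have hneg : (-t) • fieldCLM H = -(t • fieldCLM H) := by ext <;> simp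
  have h1 : NormedSpace.exp ((-t) • fieldCLM H) * NormedSpace.exp (t • fieldCLM H) = 1 := by
    rw [hneg, ← NormedSpace.exp_add_of_commute (Commute.refl (t • fieldCLM H)).neg_left,
      neg_add_cancel, NormedSpace.exp_zero]
  have h2 := congrArg (fun A : Phase d →L[ℝ] Phase d => A (z - (c, 0))) h1
  simp only [mul_apply_eq_comp, one_apply_eq_self] at h2
  simp only [flow, add_sub_cancel_left, h2, add_sub_cancel]

/-- The velocity flip as a linear map. -/
def flipCLM (d : ℕ) : Phase d →L[ℝ] Phase d :=
  (ContinuousLinearMap.fst ℝ (Vec d) (Vec d)).prod (-(ContinuousLinearMap.snd ℝ (Vec d) (Vec d)))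

theorem flipCLM_mul_self (d : ℕ) : flipCLM d * flipCLM d = 1 := by
  refine ContinuousLinearMap.ext fun z => ?_
  simp [flipCLM]

theorem flip_flip (z : Phase d) : flip (flip z) = z := by
  simp [flip]

theorem flip_sub (z z' : Phase d) : flip z - flip z' = flip (z - z') := by
  ext1
  · rfl
  · simp only [flip, Prod.snd_sub]
    abel

theorem measurable_flip : Measurable (flip : Phase d → Phase d) :=
  measurable_fst.prodMk measurable_snd.neg

/-- Flipping the velocity reverses time. -/
theorem flip_flow_flip (H : Matrix (Fin d) (Fin d) ℝ) (c : Vec d) (t : ℝ) (z : Phase d) :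
    flip (flow H c t (flip z)) = flow H c (-t) z := by
  have h1 : flipCLM d * (t • fieldCLM H) * flipCLM d = (-t) • fieldCLM H := by
    refine ContinuousLinearMap.ext fun z => ?_
    simp [flipCLM, fieldCLM]
  let _ := NormedAlgebra.restrictScalars ℚ ℝ (Phase d →L[ℝ] Phase d)
  have h2 := NormedSpace.exp_units_conj
    (⟨flipCLM d, flipCLM d, flipCLM_mul_self d, flipCLM_mul_self d⟩ : (Phase d →L[ℝ] Phase d)ˣ)
    (t • fieldCLM H)
  simp only [Units.inv_mk, h1] at h2
  have e1 : flip z - (c, 0) = flipCLM d (z - (c, 0)) := by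
    ext1 <;> simp [flip, flipCLM]
  have e2 : ∀ w : Phase d, flip ((c, 0) + w) = (c, 0) + flipCLM d w := by
    intro w
    ext1 <;> simp [flip, flipCLM]
  rw [flow, e1, e2, flow, h2]
  rfl

theorem refresh_flip (α : ℝ) (ξ : Vec d) (z : Phase d) :
    refresh α ξ (flip z) = flip (refresh α (-ξ) z) := by
  ext1
  · rfl
  · simp only [refresh, flip, smul_neg]
    abel

/-! ### Invariance of the Gaussian target under the flow -/

/-- The characteristic function of a measure on phase space. -/
noncomputable def phaseCharFun (ν : Measure (Phase d)) (p : Phase d) : ℂ :=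
  ∫ z, Complex.exp (((inner ℝ z.1 p.1 + inner ℝ z.2 p.2 : ℝ) : ℂ) * Complex.I) ∂ν

theorem ext_of_phaseCharFun {ν₁ ν₂ : Measure (Phase d)} [IsFiniteMeasure ν₁] [IsFiniteMeasure ν₂]
    (h : ∀ p, phaseCharFun ν₁ p = phaseCharFun ν₂ p) : ν₁ = ν₂ := by
  refine Measure.ext_of_charFunDual (funext fun L => ?_)
  set a := (InnerProductSpace.toDual ℝ (Vec d)).symm
    (L.comp (ContinuousLinearMap.inl ℝ (Vec d) (Vec d))) with ha
  set b := (InnerProductSpace.toDual ℝ (Vec d)).symm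
    (L.comp (ContinuousLinearMap.inr ℝ (Vec d) (Vec d))) with hb
  have hL : ∀ z : Phase d, L z = inner ℝ z.1 a + inner ℝ z.2 b := by
    intro z
    rw [real_inner_comm, real_inner_comm b, ha, hb, InnerProductSpace.toDual_symm_apply,
      InnerProductSpace.toDual_symm_apply]
    simp [← map_add]
  simp only [charFunDual_apply, hL]
  exact h (a, b)

theorem phaseCharFun_prod (ν₁ ν₂ : Measure (Vec d)) [SFinite ν₁] [SFinite ν₂] (p : Phase d) :
    phaseCharFun (ν₁.prod ν₂) p = charFun ν₁ p.1 * charFun ν₂ p.2 := by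
  simp only [phaseCharFun, charFun_apply]
  rw [← integral_prod_mul]
  congr 1
  ext z
  rw [← Complex.exp_add, ← add_mul]
  push_cast
  rfl

instance (H : Matrix (Fin d) (Fin d) ℝ) (c : Vec d) : IsProbabilityMeasure (target H c) := by
  unfold target; infer_instance

variable {H : Matrix (Fin d) (Fin d) ℝ} {m : ℝ}

theorem posDef_of_posSemidef_sub (hm : 0 < m)
    (hmH : (H - m • (1 : Matrix (Fin d) (Fin d) ℝ)).PosSemidef) : H.PosDef := by
  have h : (m • (1 : Matrix (Fin d) (Fin d) ℝ)).PosDef := Matrix.PosDef.one.smul hm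
  simpa using h.add_posSemidef hmH

theorem phaseCharFun_target (hH : H.PosDef) (c : Vec d) (p : Phase d) :
    phaseCharFun (target H c) p
      = Complex.exp (((inner ℝ c p.1 : ℝ) : ℂ) * Complex.I
          - ((crossEnergy H⁻¹ 0 p : ℝ) : ℂ) / 2) := by
  rw [target, phaseCharFun_prod, charFun_multivariateGaussian hH.inv.posSemidef,
    charFun_stdGaussian, ← Complex.exp_add, real_inner_comm c p.1, crossEnergy,
    inner_act_eq_dotProduct]
  congr 1
  push_cast
  ring

/-- The transpose of `fieldCLM H`. -/
noncomputable def dualFieldCLM (H : Matrix (Fin d) (Fin d) ℝ) : Phase d →L[ℝ] Phase d :=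
  (-((act H).comp (ContinuousLinearMap.snd ℝ (Vec d) (Vec d)))).prod
    (ContinuousLinearMap.fst ℝ (Vec d) (Vec d))

/-- The flow of the transposed field is the transpose of the flow. -/
theorem pairing_exp_fieldCLM (hH : H.IsHermitian) (p z : Phase d) (t : ℝ) :
    inner ℝ (NormedSpace.exp (t • fieldCLM H) z).1 p.1
        + inner ℝ (NormedSpace.exp (t • fieldCLM H) z).2 p.2
      = inner ℝ z.1 (NormedSpace.exp (t • dualFieldCLM H) p).1
        + inner ℝ z.2 (NormedSpace.exp (t • dualFieldCLM H) p).2 := by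
  set A : ℝ → Phase d := fun s => NormedSpace.exp (s • fieldCLM H) z with hA
  set B : ℝ → Phase d := fun s => NormedSpace.exp (s • dualFieldCLM H) p with hB
  have hAd : ∀ s, HasDerivAt A (fieldCLM H (A s)) s := hasDerivAt_exp_smul_apply _ z
  have hBd : ∀ s, HasDerivAt (fun s => B (t - s)) (-dualFieldCLM H (B (t - s))) s := by
    intro s
    have h := (hasDerivAt_exp_smul_apply (dualFieldCLM H) p (t - s)).scomp s
      ((hasDerivAt_id s).const_sub t)
    simp only [neg_smul, one_smul] at h
    exact h
  -- `s ↦ ⟨exp (s K) z, exp ((t - s) K') p⟩` is constant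
  have hd : ∀ s, HasDerivAt (fun s => inner ℝ (A s).1 (B (t - s)).1
      + inner ℝ (A s).2 (B (t - s)).2) 0 s := by
    intro s
    have hA1 : HasDerivAt (fun s => (A s).1) (fieldCLM H (A s)).1 s :=
      (hasFDerivAt_fst (p := A s)).comp_hasDerivAt s (hAd s)
    have hA2 : HasDerivAt (fun s => (A s).2) (fieldCLM H (A s)).2 s :=
      (hasFDerivAt_snd (p := A s)).comp_hasDerivAt s (hAd s)
    have hB1 : HasDerivAt (fun s => (B (t - s)).1) (-dualFieldCLM H (B (t - s))).1 s :=
      HasFDerivAt.comp_hasDerivAt (f := fun s => B (t - s)) s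
        (hasFDerivAt_fst (p := B (t - s))) (hBd s)
    have hB2 : HasDerivAt (fun s => (B (t - s)).2) (-dualFieldCLM H (B (t - s))).2 s :=
      HasFDerivAt.comp_hasDerivAt (f := fun s => B (t - s)) s
        (hasFDerivAt_snd (p := B (t - s))) (hBd s)
    refine ((hA1.inner ℝ hB1).add (hA2.inner ℝ hB2)).congr_deriv ?_
    simp [fieldCLM, dualFieldCLM, inner_act_comm hH]
  have hconst := is_const_of_deriv_eq_zero (fun s => (hd s).differentiableAt)
    (fun s => (hd s).deriv) t 0
  have hA0 : A 0 = z := exp_zero_smul_apply _ _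
  have hB0 : B 0 = p := exp_zero_smul_apply _ _
  simpa [hA0, hB0] using hconst

theorem act_act_inv (hH : H.PosDef) (x : Vec d) : act H (act H⁻¹ x) = x := by
  have h : act H * act H⁻¹ = 1 := by
    rw [act, act, ← map_mul,
      Matrix.mul_nonsing_inv _ ((Matrix.isUnit_iff_isUnit_det H).1 hH.isUnit), map_one]
  exact congrArg (fun A : Vec d →L[ℝ] Vec d => A x) h

/-- The covariance of the target is preserved by the transposed flow. -/
theorem crossEnergy_inv_exp_dualFieldCLM (hH : H.PosDef) (p : Phase d) (t : ℝ) :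
    crossEnergy H⁻¹ 0 (NormedSpace.exp (t • dualFieldCLM H) p) = crossEnergy H⁻¹ 0 p := by
  have hd : ∀ s : ℝ, HasDerivAt
      (fun s : ℝ => crossEnergy H⁻¹ 0 (NormedSpace.exp (s • dualFieldCLM H) p)) 0 s := by
    intro s
    have h := (hasFDerivAt_crossEnergy hH.inv.1 0 _).comp_hasDerivAt s
      (hasDerivAt_exp_smul_apply (dualFieldCLM H) p s)
    refine h.congr_deriv ?_
    set w := NormedSpace.exp (s • dualFieldCLM H) p
    have e : dualFieldCLM H w = (-act H w.2, w.1) := rfl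
    rw [crossEnergyDeriv_apply, e, inner_neg_right, inner_act_comm hH.1, act_act_inv hH,
      real_inner_comm w.1 w.2]
    ring
  have hconst := is_const_of_deriv_eq_zero (fun s => (hd s).differentiableAt)
    (fun s => (hd s).deriv) t 0
  simpa [exp_zero_smul_apply] using hconst

theorem measurable_flow_right (H : Matrix (Fin d) (Fin d) ℝ) (c : Vec d) (t : ℝ) :
    Measurable (flow H c t) := by
  have h := (measurable_flow H c).comp (measurable_prodMk_left (x := t))
  exact h

theorem map_flow_target (hH : H.PosDef) (c : Vec d) (t : ℝ) :
    (target H c).map (flow H c t) = target H c := by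
  have hm := measurable_flow_right H c t
  have : IsProbabilityMeasure ((target H c).map (flow H c t)) :=
    Measure.isProbabilityMeasure_map hm.aemeasurable
  refine ext_of_phaseCharFun fun p => ?_
  set q := NormedSpace.exp (t • dualFieldCLM H) p with hq
  have hpair : ∀ z : Phase d, inner ℝ (flow H c t z).1 p.1 + inner ℝ (flow H c t z).2 p.2
      = (inner ℝ c p.1 - inner ℝ c q.1) + (inner ℝ z.1 q.1 + inner ℝ z.2 q.2) := by
    intro z
    have h := pairing_exp_fieldCLM hH.1 p (z - (c, 0)) t
    simp only [Prod.fst_sub, Prod.snd_sub, inner_sub_left, sub_zero, ← hq] at h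
    simp only [flow, Prod.fst_add, Prod.snd_add, inner_add_left, zero_add]
    linarith
  have h1 : phaseCharFun ((target H c).map (flow H c t)) p
      = Complex.exp (((inner ℝ c p.1 - inner ℝ c q.1 : ℝ) : ℂ) * Complex.I)
        * phaseCharFun (target H c) q := by
    rw [phaseCharFun, integral_map hm.aemeasurable, phaseCharFun, ← integral_const_mul]
    · refine integral_congr_ae (Filter.Eventually.of_forall fun z => ?_)
      simp only [hpair, ← Complex.exp_add, ← add_mul]
      push_cast
      rfl
    · exact Continuous.aestronglyMeasurable (by fun_prop)
  rw [h1, phaseCharFun_target hH, phaseCharFun_target hH, ← Complex.exp_add,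
    hq, crossEnergy_inv_exp_dualFieldCLM hH]
  congr 1
  push_cast
  ring

/-! ### Reversibility of the refreshment -/

theorem map_neg_stdGaussian : (stdGaussian (Vec d)).map (fun ξ => -ξ) = stdGaussian (Vec d) :=
  stdGaussian_map (LinearIsometryEquiv.neg ℝ)

/-- The law of a velocity before and after refreshment is exchangeable. -/
theorem map_refresh_swap {α : ℝ} (hα0 : 0 ≤ α) (hα1 : α < 1) :
    ((stdGaussian (Vec d)).prod (stdGaussian (Vec d))).map
        (fun q => (q.1, α • q.1 + Real.sqrt (1 - α ^ 2) • q.2))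
      = ((stdGaussian (Vec d)).prod (stdGaussian (Vec d))).map
        (fun q => (α • q.1 + Real.sqrt (1 - α ^ 2) • q.2, q.1)) := by
  set b := Real.sqrt (1 - α ^ 2) with hb
  have hb2 : b ^ 2 = 1 - α ^ 2 := Real.sq_sqrt (by nlinarith)
  have hm1 : Measurable fun q : Vec d × Vec d => (q.1, α • q.1 + b • q.2) := by fun_prop
  have hm2 : Measurable fun q : Vec d × Vec d => (α • q.1 + b • q.2, q.1) := by fun_prop
  have := Measure.isProbabilityMeasure_map
    (μ := (stdGaussian (Vec d)).prod (stdGaussian (Vec d))) hm1.aemeasurable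
  have := Measure.isProbabilityMeasure_map
    (μ := (stdGaussian (Vec d)).prod (stdGaussian (Vec d))) hm2.aemeasurable
  -- both characteristic functions at `(p, q)` are `exp (-(|p|² + 2 α ⟨p, q⟩ + |q|²) / 2)`
  have key : ∀ u w : Vec d, phaseCharFun ((stdGaussian (Vec d)).prod (stdGaussian (Vec d)))
      (u + α • w, b • w)
      = Complex.exp (-((‖u‖ ^ 2 + 2 * α * inner ℝ u w + ‖w‖ ^ 2 : ℝ) : ℂ) / 2) := by
    intro u w
    rw [phaseCharFun_prod, charFun_stdGaussian, charFun_stdGaussian, ← Complex.exp_add]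
    have e : ‖u + α • w‖ ^ 2 + ‖b • w‖ ^ 2 = ‖u‖ ^ 2 + 2 * α * inner ℝ u w + ‖w‖ ^ 2 := by
      rw [norm_add_sq_real, norm_smul, norm_smul, mul_pow, mul_pow, inner_smul_right,
        Real.norm_eq_abs, Real.norm_eq_abs, sq_abs, sq_abs, hb2]
      ring
    rw [← e]
    congr 1
    push_cast
    ring
  refine ext_of_phaseCharFun fun p => ?_
  have h1 : phaseCharFun (((stdGaussian (Vec d)).prod (stdGaussian (Vec d))).map
      (fun q => (q.1, α • q.1 + b • q.2))) p
      = phaseCharFun ((stdGaussian (Vec d)).prod (stdGaussian (Vec d)))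
        (p.1 + α • p.2, b • p.2) := by
    rw [phaseCharFun, integral_map hm1.aemeasurable
      (Continuous.aestronglyMeasurable (by fun_prop)), phaseCharFun]
    simp only [inner_add_left, inner_add_right, inner_smul_left, inner_smul_right, add_assoc,
      RCLike.conj_to_real]
  have h2 : phaseCharFun (((stdGaussian (Vec d)).prod (stdGaussian (Vec d))).map
      (fun q => (α • q.1 + b • q.2, q.1))) p
      = phaseCharFun ((stdGaussian (Vec d)).prod (stdGaussian (Vec d)))
        (p.2 + α • p.1, b • p.1) := by
    rw [phaseCharFun, integral_map hm2.aemeasurable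
      (Continuous.aestronglyMeasurable (by fun_prop)), phaseCharFun]
    simp only [inner_add_left, inner_add_right, inner_smul_left, inner_smul_right,
      RCLike.conj_to_real]
    congr 1
    ext z
    congr 3
    ring
  rw [h1, h2, key, key, real_inner_comm p.2 p.1]
  congr 4
  ring

/-- The refreshment is reversible with respect to the target. -/
theorem lintegral_refresh_comm {α : ℝ} (hα0 : 0 ≤ α) (hα1 : α < 1)
    (H : Matrix (Fin d) (Fin d) ℝ) (c : Vec d) {g h : Phase d → ℝ≥0∞} (hg : Measurable g)
    (hh : Measurable h) :
    ∫⁻ z, ∫⁻ ξ, g z * h (refresh α ξ z) ∂(stdGaussian (Vec d)) ∂(target H c)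
      = ∫⁻ z, ∫⁻ ξ, g (refresh α ξ z) * h z ∂(stdGaussian (Vec d)) ∂(target H c) := by
  have hr : Measurable fun q : Phase d × Vec d => refresh α q.2 q.1 :=
    (measurable_refresh α).comp (measurable_snd.prodMk measurable_fst)
  have hm1 : Measurable fun q : Phase d × Vec d => g q.1 * h (refresh α q.2 q.1) :=
    (hg.comp measurable_fst).mul (hh.comp hr)
  have hm2 : Measurable fun q : Phase d × Vec d => g (refresh α q.2 q.1) * h q.1 :=
    (hg.comp hr).mul (hh.comp measurable_fst)
  rw [target, lintegral_prod _ hm1.lintegral_prod_right'.aemeasurable,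
    lintegral_prod _ hm2.lintegral_prod_right'.aemeasurable]
  refine lintegral_congr fun x => ?_
  have hx : Measurable fun q : Vec d × Vec d => g (x, q.1) * h (x, q.2) :=
    (hg.comp (measurable_const.prodMk measurable_fst)).mul
      (hh.comp (measurable_const.prodMk measurable_snd))
  have hk1 : Measurable fun q : Vec d × Vec d =>
      (q.1, α • q.1 + Real.sqrt (1 - α ^ 2) • q.2) := by fun_prop
  have hk2 : Measurable fun q : Vec d × Vec d =>
      (α • q.1 + Real.sqrt (1 - α ^ 2) • q.2, q.1) := by fun_prop
  have e1 := lintegral_map (μ := (stdGaussian (Vec d)).prod (stdGaussian (Vec d))) hx hk1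
  have e2 := lintegral_map (μ := (stdGaussian (Vec d)).prod (stdGaussian (Vec d))) hx hk2
  rw [map_refresh_swap hα0 hα1] at e1
  have e3 := lintegral_prod (μ := stdGaussian (Vec d)) (ν := stdGaussian (Vec d)) _
    (hx.comp hk1).aemeasurable
  have e4 := lintegral_prod (μ := stdGaussian (Vec d)) (ν := stdGaussian (Vec d)) _
    (hx.comp hk2).aemeasurable
  exact e3.symm.trans ((e1.symm.trans e2).trans e4)

end

/-! ### Time reversal -/

section

variable {d : ℕ} {H : Matrix (Fin d) (Fin d) ℝ}

theorem _root_.Measurable.flow {A : Type*} [MeasurableSpace A] {t : A → ℝ} (ht : Measurable t)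
    (H : Matrix (Fin d) (Fin d) ℝ) (c : Vec d) {y : A → Phase d} (hy : Measurable y) :
    Measurable fun a => flow H c (t a) (y a) := by
  have h := (measurable_flow H c).comp (ht.prodMk hy)
  exact h

theorem _root_.Measurable.refresh {A : Type*} [MeasurableSpace A] {ξ : A → Vec d}
    (hξ : Measurable ξ) (α : ℝ) {y : A → Phase d} (hy : Measurable y) :
    Measurable fun a => refresh α (ξ a) (y a) := by
  have h := (measurable_refresh α).comp (hξ.prodMk hy)
  exact h

theorem lintegral_comp_flow (hH : H.PosDef) (c : Vec d) (t : ℝ) {G : Phase d → ℝ≥0∞}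
    (hG : Measurable G) : ∫⁻ z, G (flow H c t z) ∂(target H c) = ∫⁻ z, G z ∂(target H c) := by
  conv_rhs => rw [← map_flow_target hH c t]
  rw [lintegral_map hG (measurable_flow_right H c t)]

theorem lintegral_neg_stdGaussian {k : Vec d → ℝ≥0∞} (hk : Measurable k) :
    ∫⁻ ξ, k (-ξ) ∂(stdGaussian (Vec d)) = ∫⁻ ξ, k ξ ∂(stdGaussian (Vec d)) := by
  conv_rhs => rw [← map_neg_stdGaussian]
  rw [lintegral_map hk measurable_neg]

/-- One step of the first-jump decomposition, moved to the other factor by the invariance of the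
target under the flow and the reversibility of the refreshment. -/
theorem lintegral_flow_refresh_comm (hH : H.PosDef) (c : Vec d) {α : ℝ} (hα0 : 0 ≤ α)
    (hα1 : α < 1) (s : ℝ) {g h : Phase d → ℝ≥0∞} (hg : Measurable g) (hh : Measurable h) :
    ∫⁻ z, ∫⁻ ξ, g z * h (refresh α ξ (flow H c s z)) ∂(stdGaussian (Vec d)) ∂(target H c)
      = ∫⁻ ξ, ∫⁻ z, g (flow H c (-s) (refresh α ξ z)) * h z ∂(target H c)
          ∂(stdGaussian (Vec d)) := by
  have hr : Measurable fun q : Phase d × Vec d => refresh α q.2 q.1 :=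
    (measurable_refresh α).comp (measurable_snd.prodMk measurable_fst)
  have hgm : Measurable fun z => g (flow H c (-s) z) := hg.comp (measurable_flow_right H c (-s))
  have h1 : Measurable fun z => ∫⁻ ξ, g (flow H c (-s) z) * h (refresh α ξ z)
      ∂(stdGaussian (Vec d)) :=
    Measurable.lintegral_prod_right' (f := fun q : Phase d × Vec d =>
      g (flow H c (-s) q.1) * h (refresh α q.2 q.1)) ((hgm.comp measurable_fst).mul (hh.comp hr))
  have h2 := lintegral_comp_flow hH c s h1
  simp only [flow_neg_flow] at h2
  rw [h2, lintegral_refresh_comm hα0 hα1 H c hgm hh, lintegral_lintegral_swap]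
  exact ((hgm.comp hr).mul (hh.comp measurable_fst)).aemeasurable

/-- Integrals over a point and one step can be taken waiting time first. -/
theorem lintegral_stepLaw_swap {lam : ℝ} [IsProbabilityMeasure (expMeasure lam)]
    (ν : Measure (Phase d)) [SFinite ν] {G : Phase d × (ℝ × Vec d) → ℝ≥0∞} (hG : Measurable G) :
    ∫⁻ z, ∫⁻ p, G (z, p) ∂(stepLaw d lam) ∂ν
      = ∫⁻ s, ∫⁻ z, ∫⁻ ξ, G (z, (s, ξ)) ∂(stdGaussian (Vec d)) ∂ν ∂(expMeasure lam) := by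
  have h1 : ∀ z, ∫⁻ p, G (z, p) ∂(stepLaw d lam)
      = ∫⁻ s, ∫⁻ ξ, G (z, (s, ξ)) ∂(stdGaussian (Vec d)) ∂(expMeasure lam) := fun z =>
    lintegral_prod _ (hG.comp (measurable_const.prodMk measurable_id)).aemeasurable
  simp_rw [h1]
  rw [lintegral_lintegral_swap]
  have hm : Measurable fun q : (Phase d × ℝ) × Vec d => G (q.1.1, (q.1.2, q.2)) :=
    hG.comp (measurable_fst.fst.prodMk (measurable_fst.snd.prodMk measurable_snd))
  exact hm.lintegral_prod_right'.aemeasurable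

/-- The time reversal of the process is its conjugate by the velocity flip. The induction trades
the first jump of the process for the last jump of the reversed process. -/
theorem lintegral_mul_jumpExp (hH : H.PosDef) (c : Vec d) {α lam : ℝ} (hα0 : 0 ≤ α)
    (hα1 : α < 1) (hlam : 0 < lam) (n : ℕ) (t : ℝ) {f g : Phase d → ℝ≥0∞} (hf : Measurable f)
    (hg : Measurable g) :
    ∫⁻ z, g z * jumpExp lam (flow H c) (refresh α) n t f z ∂(target H c)
      = ∫⁻ z, f z * jumpExp lam (flow H c) (refresh α) n t (fun y => g (flip y)) (flip z)
          ∂(target H c) := by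
  have := isProbabilityMeasure_expMeasure hlam
  have hφ := measurable_flow H c
  have hr := measurable_refresh (d := d) α
  have hgf : Measurable fun y => g (flip y) := hg.comp measurable_flip
  induction n generalizing t f g with
  | zero =>
    rcases lt_or_ge t 0 with ht | ht
    · simp [jumpExp_of_neg ht]
    simp only [jumpExp_zero hlam hφ hr ht hf, jumpExp_zero hlam hφ hr ht hgf, flip_flow_flip]
    have h1 : Measurable fun z => g (flow H c (-t) z) * (ENNReal.ofReal (Real.exp (-(lam * t)))
        * f z) := (hg.comp (measurable_flow_right H c (-t))).mul (hf.const_mul _)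
    have h2 := lintegral_comp_flow hH c t h1
    simp only [flow_neg_flow] at h2
    rw [h2]
    refine lintegral_congr fun z => ?_
    ring
  | succ n ih =>
    have hstep : Measurable fun q : (ℝ × Vec d) × Phase d =>
        flip (flow H c q.1.1 (refresh α q.1.2 q.2)) :=
      measurable_flip.comp
        (measurable_fst.fst.flow H c (measurable_fst.snd.refresh α measurable_snd))
    have hK1 : Measurable fun q : Phase d × (ℝ × Vec d) =>
        jumpExp lam (flow H c) (refresh α) n (t - q.2.1) f
          (refresh α q.2.2 (flow H c q.2.1 q.1)) :=
      measurable_jumpExp hφ hr n (measurable_const.sub measurable_snd.fst)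
        (hf.comp measurable_snd)
        (measurable_snd.snd.refresh α (measurable_snd.fst.flow H c measurable_fst))
    have hK2 : Measurable fun q : Phase d × (ℝ × Vec d) =>
        jumpExp lam (flow H c) (refresh α) n (t - q.2.1)
          (fun y => g (flip (flow H c q.2.1 (refresh α q.2.2 y)))) (flip q.1) :=
      measurable_jumpExp hφ hr n (measurable_const.sub measurable_snd.fst)
        (hg.comp (hstep.comp (measurable_fst.snd.prodMk measurable_snd)))
        (measurable_flip.comp measurable_fst)
    have e1 : ∀ z, g z * jumpExp lam (flow H c) (refresh α) (n + 1) t f z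
        = ∫⁻ p, g z * jumpExp lam (flow H c) (refresh α) n (t - p.1) f
            (refresh α p.2 (flow H c p.1 z)) ∂(stepLaw d lam) := by
      intro z
      rw [jumpExp_succ hφ hr n t hf z, lintegral_const_mul]
      exact hK1.comp (measurable_prodMk_left (x := z))
    have e2 : ∀ z, f z * jumpExp lam (flow H c) (refresh α) (n + 1) t (fun y => g (flip y))
          (flip z)
        = ∫⁻ p, f z * jumpExp lam (flow H c) (refresh α) n (t - p.1)
            (fun y => g (flip (flow H c p.1 (refresh α p.2 y)))) (flip z) ∂(stepLaw d lam) := by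
      intro z
      rw [jumpExp_succ_last hlam hφ hr n t hgf (flip z), lintegral_const_mul]
      exact hK2.comp (measurable_prodMk_left (x := z))
    simp_rw [e1, e2]
    rw [lintegral_stepLaw_swap (G := fun q => g q.1 * jumpExp lam (flow H c) (refresh α) n
        (t - q.2.1) f (refresh α q.2.2 (flow H c q.2.1 q.1))) _
        ((hg.comp measurable_fst).mul hK1),
      lintegral_stepLaw_swap (G := fun q => f q.1 * jumpExp lam (flow H c) (refresh α) n
        (t - q.2.1) (fun y => g (flip (flow H c q.2.1 (refresh α q.2.2 y)))) (flip q.1)) _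
        ((hf.comp measurable_fst).mul hK2)]
    refine lintegral_congr fun s => ?_
    have hh : Measurable fun z => jumpExp lam (flow H c) (refresh α) n (t - s) f z :=
      measurable_jumpExp hφ hr n measurable_const (hf.comp measurable_snd) measurable_id
    have hK3 : Measurable fun q : Vec d × Phase d =>
        f q.2 * jumpExp lam (flow H c) (refresh α) n (t - s)
          (fun y => g (flip (flow H c s (refresh α q.1 y)))) (flip q.2) :=
      (hf.comp measurable_snd).mul
        (hK2.comp (measurable_snd.prodMk (measurable_const.prodMk measurable_fst)))
    change ∫⁻ z, ∫⁻ ξ, g z * jumpExp lam (flow H c) (refresh α) n (t - s) f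
      (refresh α ξ (flow H c s z)) ∂(stdGaussian (Vec d)) ∂(target H c) = _
    rw [lintegral_flow_refresh_comm hH c hα0 hα1 s hg hh]
    -- the induction hypothesis applies for each fixed first jump; the flip turns it into a jump
    -- with the reflected normal vector `-ξ`
    have e3 : ∀ ξ : Vec d, ∫⁻ z, g (flow H c (-s) (refresh α ξ z))
          * jumpExp lam (flow H c) (refresh α) n (t - s) f z ∂(target H c)
        = ∫⁻ z, f z * jumpExp lam (flow H c) (refresh α) n (t - s)
          (fun y => g (flip (flow H c s (refresh α (-ξ) y)))) (flip z) ∂(target H c) := by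
      intro ξ
      have hgξ : Measurable fun z => g (flow H c (-s) (refresh α ξ z)) :=
        hg.comp ((measurable_flow_right H c (-s)).comp
          (measurable_const.refresh α measurable_id))
      rw [ih (t - s) hf hgξ (hgξ.comp measurable_flip)]
      simp only [refresh_flip, ← flip_flow_flip H c s, flip_flip]
    simp_rw [e3]
    rw [lintegral_neg_stdGaussian (k := fun ξ => ∫⁻ z, f z * jumpExp lam (flow H c) (refresh α) n
      (t - s) (fun y => g (flip (flow H c s (refresh α ξ y)))) (flip z) ∂(target H c))
      hK3.lintegral_prod_right', lintegral_lintegral_swap hK3.aemeasurable]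

/-! ### The transition kernel -/

/-- The transition kernel of RHMC at time `t`. -/
noncomputable def transition (H : Matrix (Fin d) (Fin d) ℝ) (c : Vec d) (α lam t : ℝ)
    [IsProbabilityMeasure (expMeasure lam)] : Kernel (Phase d) (Phase d) where
  toFun z := (noise d lam).map fun ω => path H c α z t ω
  measurable' := by
    refine Measure.measurable_of_measurable_coe _ fun s hs => ?_
    simp_rw [Measure.map_apply (measurable_path_right H c α _ t) hs]
    exact measurable_measure_prodMk_left (measurable_path H c α t hs)

/-- The transition kernel conjugated by the velocity flip, which describes the time-reversed
process. -/
noncomputable def flippedTransition (H : Matrix (Fin d) (Fin d) ℝ) (c : Vec d) (α lam t : ℝ)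
    [IsProbabilityMeasure (expMeasure lam)] : Kernel (Phase d) (Phase d) :=
  ((transition H c α lam t).map flip).comap flip measurable_flip

theorem transition_apply (H : Matrix (Fin d) (Fin d) ℝ) (c : Vec d) (α lam t : ℝ)
    [IsProbabilityMeasure (expMeasure lam)] (z : Phase d) :
    transition H c α lam t z = (noise d lam).map fun ω => path H c α z t ω := rfl

instance (H : Matrix (Fin d) (Fin d) ℝ) (c : Vec d) (α lam t : ℝ)
    [IsProbabilityMeasure (expMeasure lam)] : IsMarkovKernel (transition H c α lam t) :=
  ⟨fun z => by
    rw [transition_apply]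
    exact Measure.isProbabilityMeasure_map (measurable_path_right H c α z t).aemeasurable⟩

instance (H : Matrix (Fin d) (Fin d) ℝ) (c : Vec d) (α lam t : ℝ)
    [IsProbabilityMeasure (expMeasure lam)] : IsMarkovKernel (flippedTransition H c α lam t) := by
  have := Kernel.IsMarkovKernel.map (transition H c α lam t) measurable_flip
  unfold flippedTransition
  infer_instance

theorem flippedTransition_apply (H : Matrix (Fin d) (Fin d) ℝ) (c : Vec d) (α lam t : ℝ)
    [IsProbabilityMeasure (expMeasure lam)] (z : Phase d) :
    flippedTransition H c α lam t z = (transition H c α lam t (flip z)).map flip := by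
  rw [flippedTransition, Kernel.comap_apply, Kernel.map_apply _ measurable_flip]

theorem lintegral_transition {lam : ℝ} (hlam : 0 < lam) [IsProbabilityMeasure (expMeasure lam)]
    (c : Vec d) (α : ℝ) {t : ℝ} (ht : 0 ≤ t) {f : Phase d → ℝ≥0∞} (hf : Measurable f)
    (z : Phase d) :
    ∫⁻ y, f y ∂(transition H c α lam t z)
      = ∑' n, jumpExp lam (flow H c) (refresh α) n t f z := by
  rw [transition_apply, lintegral_map hf (measurable_path_right H c α z t),
    ← lintegral_jumpPath hlam (measurable_flow H c) (measurable_refresh α) ht hf]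
  simp_rw [path_eq_jumpPath]

/-- The transition kernel and its conjugate by the velocity flip are adjoint with respect to the
target. -/
theorem lintegral_mul_transition (hH : H.PosDef) (c : Vec d) {α lam : ℝ} (hα0 : 0 ≤ α)
    (hα1 : α < 1) (hlam : 0 < lam) [IsProbabilityMeasure (expMeasure lam)] {t : ℝ} (ht : 0 ≤ t)
    {f g : Phase d → ℝ≥0∞} (hf : Measurable f) (hg : Measurable g) :
    ∫⁻ z, g z * ∫⁻ y, f y ∂(transition H c α lam t z) ∂(target H c)
      = ∫⁻ z, f z * ∫⁻ y, g y ∂(flippedTransition H c α lam t z) ∂(target H c) := by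
  have hφ := measurable_flow H c
  have hr := measurable_refresh (d := d) α
  have hgf : Measurable fun y => g (flip y) := hg.comp measurable_flip
  have e : ∀ z, ∫⁻ y, g y ∂(flippedTransition H c α lam t z)
      = ∑' n, jumpExp lam (flow H c) (refresh α) n t (fun y => g (flip y)) (flip z) := by
    intro z
    rw [flippedTransition_apply, lintegral_map hg measurable_flip,
      lintegral_transition hlam c α ht hgf]
  simp_rw [e, lintegral_transition hlam c α ht hf, ← ENNReal.tsum_mul_left]
  rw [lintegral_tsum, lintegral_tsum]
  · exact tsum_congr fun n => lintegral_mul_jumpExp hH c hα0 hα1 hlam n t hf hg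
  · intro n
    exact (hf.mul (measurable_jumpExp hφ hr n measurable_const (hgf.comp measurable_snd)
      measurable_flip)).aemeasurable
  · intro n
    exact (hg.mul (measurable_jumpExp hφ hr n measurable_const (hf.comp measurable_snd)
      measurable_id)).aemeasurable

end

/-! ### From contraction of Lipschitz constants to contraction in `L²` -/

/-- A sequence `b` with `b (n+1)² ≤ b n * b (n+2)` has increasing ratios, so that its first ratio
is at most its exponential growth rate. -/
theorem le_mul_of_sq_le_mul {b : ℕ → ℝ} (h0 : ∀ n, 0 ≤ b n)
    (hc : ∀ n, b (n + 1) ^ 2 ≤ b n * b (n + 2)) {ρ A : ℝ} (hρ : 0 < ρ)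
    (hA : ∀ n, b n ≤ A * ρ ^ n) : b 1 ≤ ρ * b 0 := by
  by_contra! hlt
  have hb0 : 0 < b 0 := by
    refine lt_of_le_of_ne (h0 0) fun h => ?_
    have h1 := hc 0
    rw [← h, zero_mul] at h1
    rw [← h, mul_zero] at hlt
    nlinarith
  have hr : ρ < b 1 / b 0 := by rwa [lt_div_iff₀ hb0]
  set r := b 1 / b 0 with hrdef
  have hr0 : 0 < r := hρ.trans hr
  have hstep : ∀ n, 0 < b n ∧ r * b n ≤ b (n + 1) := by
    intro n
    induction n with
    | zero => exact ⟨hb0, by rw [hrdef, div_mul_cancel₀ _ hb0.ne']⟩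
    | succ n ih =>
      have hpos : 0 < b (n + 1) := lt_of_lt_of_le (mul_pos hr0 ih.1) ih.2
      refine ⟨hpos, ?_⟩
      have h1 := hc n
      have h2 : r * b (n + 1) * b n ≤ b (n + 2) * b n := by nlinarith [ih.2]
      exact le_of_mul_le_mul_right h2 ih.1
  have hpow : ∀ n, r ^ n * b 0 ≤ b n := by
    intro n
    induction n with
    | zero => simp
    | succ n ih =>
      calc r ^ (n + 1) * b 0 = r * (r ^ n * b 0) := by ring
        _ ≤ r * b n := mul_le_mul_of_nonneg_left ih hr0.le
        _ ≤ b (n + 1) := (hstep n).2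
  obtain ⟨n, hn⟩ := pow_unbounded_of_one_lt (A / b 0) ((one_lt_div hρ).2 hr)
  rw [div_pow, div_lt_div_iff₀ hb0 (pow_pos hρ n)] at hn
  linarith [hpow n, hA n]

section

variable {E : Type*} [MeasurableSpace E]

/-- Bounded measurable functions. -/
structure BoundedMeasurable (f : E → ℝ) : Prop where
  measurable : Measurable f
  bounded : ∃ C, ∀ x, |f x| ≤ C

theorem BoundedMeasurable.integrable {f : E → ℝ} (hf : BoundedMeasurable f) (ν : Measure E)
    [IsFiniteMeasure ν] : Integrable f ν := by
  obtain ⟨C, hC⟩ := hf.bounded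
  exact Integrable.of_bound hf.measurable.aestronglyMeasurable C
    (Filter.Eventually.of_forall hC)

theorem BoundedMeasurable.mul {f g : E → ℝ} (hf : BoundedMeasurable f)
    (hg : BoundedMeasurable g) : BoundedMeasurable fun x => f x * g x := by
  obtain ⟨C, hC⟩ := hf.bounded
  obtain ⟨D, hD⟩ := hg.bounded
  refine ⟨hf.measurable.mul hg.measurable, C * D, fun x => ?_⟩
  rw [abs_mul]
  exact mul_le_mul (hC x) (hD x) (abs_nonneg _) ((abs_nonneg _).trans (hC x))

theorem BoundedMeasurable.sub_const {f : E → ℝ} (hf : BoundedMeasurable f) (a : ℝ) :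
    BoundedMeasurable fun x => f x - a := by
  obtain ⟨C, hC⟩ := hf.bounded
  exact ⟨hf.measurable.sub_const a, C + |a|, fun x => (abs_sub _ _).trans (by grw [hC x])⟩

theorem BoundedMeasurable.comp {E' : Type*} [MeasurableSpace E'] {f : E → ℝ}
    (hf : BoundedMeasurable f) {S : E' → E} (hS : Measurable S) :
    BoundedMeasurable fun x => f (S x) := by
  obtain ⟨C, hC⟩ := hf.bounded
  exact ⟨hf.measurable.comp hS, C, fun x => hC _⟩

/-- The action `f ↦ ∫ f(y) K(·, dy)` of a kernel on functions. -/
noncomputable def kernelOp (K : Kernel E E) (f : E → ℝ) (z : E) : ℝ := ∫ y, f y ∂(K z)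

theorem BoundedMeasurable.kernelOp {f : E → ℝ} (hf : BoundedMeasurable f) (K : Kernel E E)
    [IsMarkovKernel K] : BoundedMeasurable (kernelOp K f) := by
  obtain ⟨C, hC⟩ := hf.bounded
  refine ⟨hf.measurable.stronglyMeasurable.integral_kernel.measurable, C, fun z => ?_⟩
  have h := norm_integral_le_of_norm_le_const (μ := K z) (f := f) (C := C)
    (Filter.Eventually.of_forall hC)
  simpa [RHMC.kernelOp] using h

/-- Two kernels are adjoint with respect to `π`. -/
def IsDual (π : Measure E) (K K' : Kernel E E) : Prop :=
  ∀ f g : E → ℝ≥0∞, Measurable f → Measurable g →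
    ∫⁻ z, g z * ∫⁻ y, f y ∂(K z) ∂π = ∫⁻ z, f z * ∫⁻ y, g y ∂(K' z) ∂π

variable {π : Measure E} {K K' : Kernel E E}

theorem IsDual.symm (h : IsDual π K K') : IsDual π K' K := fun f g hf hg => (h g f hg hf).symm

theorem IsDual.lintegral_lintegral [IsMarkovKernel K'] (h : IsDual π K K') {f : E → ℝ≥0∞}
    (hf : Measurable f) : ∫⁻ z, ∫⁻ y, f y ∂(K z) ∂π = ∫⁻ z, f z ∂π := by
  simpa using h f 1 hf measurable_one

theorem IsDual.bind_eq [IsMarkovKernel K'] (h : IsDual π K K') : π.bind K = π := by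
  refine Measure.ext fun s hs => ?_
  rw [Measure.bind_apply hs K.aemeasurable]
  have h1 := h.lintegral_lintegral (measurable_one.indicator hs)
  simpa [lintegral_indicator_one hs] using h1

theorem IsDual.ae_ae [IsMarkovKernel K'] (h : IsDual π K K') {p : E → Prop} (hp : ∀ᵐ y ∂π, p y) :
    ∀ᵐ z ∂π, ∀ᵐ y ∂(K z), p y := by
  refine Measure.ae_ae_of_ae_bind K.aemeasurable ?_
  rwa [h.bind_eq]

theorem IsDual.kernelOp_congr [IsMarkovKernel K'] (h : IsDual π K K') {f g : E → ℝ}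
    (hfg : f =ᵐ[π] g) :
    kernelOp K f =ᵐ[π] kernelOp K g := by
  filter_upwards [h.ae_ae hfg] with z hz
  exact integral_congr_ae hz

theorem IsDual.aestronglyMeasurable_kernelOp [IsMarkovKernel K'] (h : IsDual π K K') {f : E → ℝ}
    (hf : AEStronglyMeasurable f π) : AEStronglyMeasurable (kernelOp K f) π :=
  ⟨kernelOp K (hf.mk f), hf.stronglyMeasurable_mk.integral_kernel,
    h.kernelOp_congr hf.ae_eq_mk⟩

theorem eLpNorm_two_sq_eq_lintegral (ν : Measure E) (f : E → ℝ) :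
    eLpNorm f 2 ν ^ 2 = ∫⁻ z, ‖f z‖ₑ ^ 2 ∂ν := by
  have h := eLpNorm_nnreal_pow_eq_lintegral (μ := ν) (f := f) (p := 2) two_ne_zero
  simpa using h

theorem eLpNorm_two_sq_eq_integral {ν : Measure E} {f : E → ℝ} (hf : MemLp f 2 ν) :
    eLpNorm f 2 ν ^ 2 = ENNReal.ofReal (∫ z, f z ^ 2 ∂ν) := by
  rw [eLpNorm_two_sq_eq_lintegral, ofReal_integral_eq_lintegral_ofReal hf.integrable_sq
    (Filter.Eventually.of_forall fun z => sq_nonneg _)]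
  refine lintegral_congr fun z => ?_
  rw [← sq_abs, ENNReal.ofReal_pow (abs_nonneg _), Real.enorm_eq_ofReal_abs]

/-- A kernel with invariant probability measure `π` is a contraction of `L²(π)`. -/
theorem IsDual.eLpNorm_kernelOp_le [IsMarkovKernel K] [IsMarkovKernel K'] (h : IsDual π K K')
    {f : E → ℝ} (hf : AEStronglyMeasurable f π) : eLpNorm (kernelOp K f) 2 π ≤ eLpNorm f 2 π := by
  rw [eLpNorm_congr_ae (h.kernelOp_congr hf.ae_eq_mk), eLpNorm_congr_ae hf.ae_eq_mk]
  set g := hf.mk f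
  have hg : StronglyMeasurable g := hf.stronglyMeasurable_mk
  have h1 : eLpNorm (kernelOp K g) 2 π ^ 2 ≤ eLpNorm g 2 π ^ 2 := by
    rw [eLpNorm_two_sq_eq_lintegral, eLpNorm_two_sq_eq_lintegral,
      ← h.lintegral_lintegral (hg.measurable.enorm.pow_const 2)]
    refine lintegral_mono fun z => ?_
    have h2 : ‖kernelOp K g z‖ₑ ≤ eLpNorm g 2 (K z) := by
      refine (enorm_integral_le_lintegral_enorm _).trans ?_
      rw [← eLpNorm_one_eq_lintegral_enorm]
      exact eLpNorm_le_eLpNorm_of_exponent_le (by norm_num) hg.aestronglyMeasurable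
    simp only
    rw [← eLpNorm_two_sq_eq_lintegral]
    gcongr
  exact (ENNReal.pow_le_pow_left_iff two_ne_zero).1 h1

theorem IsDual.ae_integrable [IsMarkovKernel K'] (h : IsDual π K K') {f : E → ℝ}
    (hf : Integrable f π) :
    ∀ᵐ z ∂π, Integrable f (K z) := by
  have h1 := h.lintegral_lintegral hf.1.stronglyMeasurable_mk.measurable.enorm
  have h2 : ∫⁻ z, ‖hf.1.mk f z‖ₑ ∂π < ∞ := by
    rw [lintegral_congr_ae (g := fun z => ‖f z‖ₑ)
      (hf.1.ae_eq_mk.symm.mono fun z hz => congrArg _ hz)]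
    exact hf.2
  rw [← h1] at h2
  have hm : Measurable fun z => ∫⁻ y, ‖hf.1.mk f y‖ₑ ∂(K z) :=
    hf.1.stronglyMeasurable_mk.measurable.enorm.lintegral_kernel
  filter_upwards [ae_lt_top hm h2.ne, h.ae_ae hf.1.ae_eq_mk] with z hz1 hz2
  exact Integrable.congr ⟨hf.1.stronglyMeasurable_mk.aestronglyMeasurable, hz1⟩
    (Filter.EventuallyEq.symm hz2)

variable [IsProbabilityMeasure π] [IsMarkovKernel K] [IsMarkovKernel K']

/-- Duality of kernels for bounded real functions. -/
theorem IsDual.integral_mul (h : IsDual π K K') {f g : E → ℝ} (hf : BoundedMeasurable f)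
    (hg : BoundedMeasurable g) :
    ∫ z, g z * kernelOp K f z ∂π = ∫ z, f z * kernelOp K' g z ∂π := by
  have hmeas : (π.compProd K).map Prod.swap = π.compProd K' := by
    have := Measure.isProbabilityMeasure_map (μ := π.compProd K) measurable_swap.aemeasurable
    refine Measure.ext_prod fun {s t} hs ht => ?_
    rw [Measure.map_apply measurable_swap (hs.prod ht), Set.preimage_swap_prod,
      Measure.compProd_apply_prod ht hs, Measure.compProd_apply_prod hs ht,
      ← lintegral_indicator ht, ← lintegral_indicator hs]
    have h1 := h (s.indicator 1) (t.indicator 1) (measurable_one.indicator hs)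
      (measurable_one.indicator ht)
    simp only [lintegral_indicator_one hs, lintegral_indicator_one ht] at h1
    convert h1 using 2
    · ext z
      by_cases hz : z ∈ t <;> simp [hz]
    · ext z
      by_cases hz : z ∈ s <;> simp [hz]
  have hb : BoundedMeasurable fun q : E × E => g q.1 * f q.2 :=
    (hg.comp measurable_fst).mul (hf.comp measurable_snd)
  have hb' : BoundedMeasurable fun q : E × E => f q.1 * g q.2 :=
    (hf.comp measurable_fst).mul (hg.comp measurable_snd)
  have e1 := Measure.integral_compProd (hb.integrable (π.compProd K))
  have e2 := Measure.integral_compProd (hb'.integrable (π.compProd K'))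
  simp only [integral_const_mul] at e1 e2
  rw [← hmeas, integral_map measurable_swap.aemeasurable
    hb'.measurable.aestronglyMeasurable] at e2
  simp only [kernelOp]
  rw [← e1, ← e2]
  simp only [Prod.fst_swap, Prod.snd_swap, mul_comm]

theorem IsDual.integral_kernelOp (h : IsDual π K K') {f : E → ℝ} (hf : BoundedMeasurable f) :
    ∫ z, kernelOp K f z ∂π = ∫ z, f z ∂π := by
  have hone : BoundedMeasurable fun _ : E => (1 : ℝ) := ⟨measurable_const, 1, by simp⟩
  have h1 := h.integral_mul hf hone
  simpa [kernelOp] using h1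

/-- The Cauchy-Schwarz inequality for bounded functions. -/
theorem sq_integral_mul_le {f g : E → ℝ} (hf : BoundedMeasurable f) (hg : BoundedMeasurable g) :
    (∫ z, f z * g z ∂π) ^ 2 ≤ (∫ z, f z ^ 2 ∂π) * ∫ z, g z ^ 2 ∂π := by
  have i1 : Integrable (fun z => f z ^ 2) π := by
    simp_rw [sq]; exact (hf.mul hf).integrable π
  have i2 : Integrable (fun z => g z ^ 2) π := by
    simp_rw [sq]; exact (hg.mul hg).integrable π
  have i3 : Integrable (fun z => f z * g z) π := (hf.mul hg).integrable π
  have h : ∀ x : ℝ, 0 ≤ (∫ z, f z ^ 2 ∂π) * (x * x) + (2 * ∫ z, f z * g z ∂π) * x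
      + ∫ z, g z ^ 2 ∂π := by
    intro x
    have h1 : 0 ≤ ∫ z, (x * f z + g z) ^ 2 ∂π := integral_nonneg fun z => sq_nonneg _
    have h2 : ∀ z, (x * f z + g z) ^ 2 = x * x * f z ^ 2 + 2 * x * (f z * g z) + g z ^ 2 :=
      fun z => by ring
    simp_rw [h2] at h1
    have i4 : Integrable (fun z => x * x * f z ^ 2 + 2 * x * (f z * g z)) π :=
      (i1.const_mul _).add (i3.const_mul _)
    rw [integral_add i4 i2,
      integral_add (i1.const_mul _) (i3.const_mul _), integral_const_mul,
      integral_const_mul] at h1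
    linarith
  have := discrim_le_zero h
  rw [discrim] at this
  nlinarith

/-- If the `L²` norms of the iterates of the self-adjoint operator `K' K` on `f` decay at rate `κ`,
then its quadratic form at `f`, which is `‖K f‖²`, is at most `κ ‖f‖²`: by Cauchy-Schwarz the
squared norms of the iterates form a log-convex sequence. -/
theorem IsDual.integral_sq_kernelOp_le (h : IsDual π K K') {f : E → ℝ}
    (hf : BoundedMeasurable f) {κ A : ℝ} (hκ : 0 < κ)
    (hA : ∀ n, ∫ z, ((fun g => kernelOp K' (kernelOp K g))^[n] f z) ^ 2 ∂π ≤ A * (κ ^ 2) ^ n) :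
    ∫ z, kernelOp K f z ^ 2 ∂π ≤ κ * ∫ z, f z ^ 2 ∂π := by
  set Q : (E → ℝ) → E → ℝ := fun g => kernelOp K' (kernelOp K g) with hQ
  have hQb : ∀ g, BoundedMeasurable g → BoundedMeasurable (Q g) := fun g hg =>
    (hg.kernelOp K).kernelOp K'
  have hit : ∀ n, BoundedMeasurable (Q^[n] f) := by
    intro n
    induction n with
    | zero => exact hf
    | succ n ih =>
      rw [Function.iterate_succ_apply']
      exact hQb _ ih
  have hadj : ∀ u w, BoundedMeasurable u → BoundedMeasurable w →
      ∫ z, Q u z * w z ∂π = ∫ z, kernelOp K u z * kernelOp K w z ∂π := by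
    intro u w hu hw
    have h1 := h.symm.integral_mul (hu.kernelOp K) hw
    rw [← h1]
    simp only [hQ, mul_comm]
  have hself : ∀ u w, BoundedMeasurable u → BoundedMeasurable w →
      ∫ z, Q u z * w z ∂π = ∫ z, u z * Q w z ∂π := by
    intro u w hu hw
    have h1 := hadj w u hw hu
    rw [hadj u w hu hw]
    simp only [mul_comm (u _)]
    rw [h1]
    simp only [mul_comm]
  have h1 : ∫ z, (Q^[1] f z) ^ 2 ∂π ≤ κ ^ 2 * ∫ z, (Q^[0] f z) ^ 2 ∂π := by
    refine le_mul_of_sq_le_mul (b := fun n => ∫ z, (Q^[n] f z) ^ 2 ∂π)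
      (fun n => integral_nonneg fun z => sq_nonneg _) (fun n => ?_) (by positivity) hA
    have e : ∫ z, (Q^[n + 1] f z) ^ 2 ∂π = ∫ z, Q^[n] f z * Q^[n + 2] f z ∂π := by
      simp only [sq, Function.iterate_succ_apply']
      exact hself _ _ (hit n) (hQb _ (hit n))
    simp only [e]
    exact sq_integral_mul_le (hit n) (hit (n + 2))
  have h2 : (∫ z, kernelOp K f z ^ 2 ∂π) ^ 2
      ≤ (∫ z, (Q f z) ^ 2 ∂π) * ∫ z, f z ^ 2 ∂π := by
    have e : ∫ z, kernelOp K f z ^ 2 ∂π = ∫ z, Q f z * f z ∂π := by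
      rw [hadj f f hf hf]
      simp only [sq]
    rw [e]
    exact sq_integral_mul_le (hQb f hf) hf
  have h3 : 0 ≤ ∫ z, f z ^ 2 ∂π := integral_nonneg fun z => sq_nonneg _
  have h4 : (∫ z, kernelOp K f z ^ 2 ∂π) ^ 2 ≤ (κ * ∫ z, f z ^ 2 ∂π) ^ 2 := by
    simp only [Function.iterate_one, Function.iterate_zero, id] at h1
    nlinarith [mul_le_mul_of_nonneg_right h1 h3]
  exact le_of_sq_le_sq h4 (by positivity)

theorem integral_prod_sub_sq {g : E → ℝ} (hg : BoundedMeasurable g) (h0 : ∫ z, g z ∂π = 0) :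
    ∫ q : E × E, (g q.1 - g q.2) ^ 2 ∂(π.prod π) = 2 * ∫ z, g z ^ 2 ∂π := by
  have hg2 : BoundedMeasurable fun z => g z ^ 2 := by
    simp_rw [sq]; exact hg.mul hg
  have e : ∀ q : E × E, (g q.1 - g q.2) ^ 2
      = g q.1 ^ 2 - 2 * (g q.1 * g q.2) + g q.2 ^ 2 := fun q => by ring
  simp_rw [e]
  have i1 := (hg2.comp (measurable_fst (α := E) (β := E))).integrable (π.prod π)
  have i2 := (hg2.comp (measurable_snd (α := E) (β := E))).integrable (π.prod π)
  have i3 := ((hg.comp (measurable_fst (α := E) (β := E))).mul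
    (hg.comp measurable_snd)).integrable (π.prod π)
  have i4 : Integrable (fun q : E × E => g q.1 ^ 2 - 2 * (g q.1 * g q.2)) (π.prod π) :=
    i1.sub (i3.const_mul 2)
  rw [integral_add i4 i2, integral_sub i1 (i3.const_mul 2),
    integral_const_mul, integral_prod_mul, h0, integral_fun_fst (μ := π) (ν := π)
      (f := fun z => g z ^ 2), integral_fun_snd (μ := π) (ν := π) (f := fun z => g z ^ 2)]
  simp
  ring

/-- If `K' K` contracts Lipschitz constants with respect to a square integrable cost `D` by the
factor `κ`, then `‖K f‖² ≤ κ ‖f‖²` for bounded Lipschitz functions of mean zero. -/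
theorem IsDual.integral_sq_kernelOp_le_of_lipschitz (h : IsDual π K K') {D : E → E → ℝ}
    (hD : Integrable (fun q : E × E => D q.1 q.2 ^ 2) (π.prod π)) {κ : ℝ} (hκ : 0 < κ)
    (hQ : ∀ (L : ℝ) (f : E → ℝ), 0 ≤ L → BoundedMeasurable f → (∀ x y, |f x - f y| ≤ L * D x y) →
      ∀ x y, |kernelOp K' (kernelOp K f) x - kernelOp K' (kernelOp K f) y| ≤ κ * L * D x y)
    {L : ℝ} {f : E → ℝ} (hL0 : 0 ≤ L) (hf : BoundedMeasurable f)
    (hL : ∀ x y, |f x - f y| ≤ L * D x y) (h0 : ∫ z, f z ∂π = 0) :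
    ∫ z, kernelOp K f z ^ 2 ∂π ≤ κ * ∫ z, f z ^ 2 ∂π := by
  set Q : (E → ℝ) → E → ℝ := fun g => kernelOp K' (kernelOp K g) with hQdef
  have hit : ∀ n, BoundedMeasurable (Q^[n] f) ∧ (∫ z, Q^[n] f z ∂π = 0) ∧
      ∀ x y, |Q^[n] f x - Q^[n] f y| ≤ κ ^ n * L * D x y := by
    intro n
    induction n with
    | zero => exact ⟨hf, h0, by simpa using hL⟩
    | succ n ih =>
      rw [Function.iterate_succ_apply']
      refine ⟨(ih.1.kernelOp K).kernelOp K', ?_, fun x y => ?_⟩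
      · rw [hQdef, h.symm.integral_kernelOp (ih.1.kernelOp K), h.integral_kernelOp ih.1, ih.2.1]
      · have h1 := hQ _ _ (by positivity) ih.1 ih.2.2 x y
        rwa [← mul_assoc, ← pow_succ'] at h1
  refine h.integral_sq_kernelOp_le hf hκ
    (A := L ^ 2 / 2 * ∫ q : E × E, D q.1 q.2 ^ 2 ∂(π.prod π)) fun n => ?_
  obtain ⟨hb, hz, hl⟩ := hit n
  have e := integral_prod_sub_sq hb hz
  have hle : ∫ q : E × E, (Q^[n] f q.1 - Q^[n] f q.2) ^ 2 ∂(π.prod π)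
      ≤ ∫ q : E × E, (κ ^ n * L) ^ 2 * D q.1 q.2 ^ 2 ∂(π.prod π) := by
    refine integral_mono_of_nonneg (Filter.Eventually.of_forall fun q => sq_nonneg _)
      (hD.const_mul _) (Filter.Eventually.of_forall fun q => ?_)
    have h1 := hl q.1 q.2
    simp only
    rw [← sq_abs, ← mul_pow]
    exact pow_le_pow_left₀ (abs_nonneg _) h1 2
  rw [integral_const_mul] at hle
  have e2 : (κ ^ n * L) ^ 2 = (κ ^ 2) ^ n * L ^ 2 := by
    rw [mul_pow, ← pow_mul, ← pow_mul, mul_comm n]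
  rw [e2] at hle
  linarith

theorem BoundedMeasurable.memLp {f : E → ℝ} (hf : BoundedMeasurable f) (ν : Measure E)
    [IsFiniteMeasure ν] : MemLp f 2 ν := by
  obtain ⟨C, hC⟩ := hf.bounded
  exact MemLp.of_bound hf.measurable.aestronglyMeasurable C (Filter.Eventually.of_forall hC)

/-- The bound of `IsDual.integral_sq_kernelOp_le_of_lipschitz`, extended from Lipschitz functions
to all of `L²` by density. -/
theorem IsDual.eLpNorm_kernelOp_le_of_lipschitz (h : IsDual π K K') {D : E → E → ℝ}
    (hD : Integrable (fun q : E × E => D q.1 q.2 ^ 2) (π.prod π)) {κ : ℝ} (hκ : 0 < κ)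
    (hQ : ∀ (L : ℝ) (f : E → ℝ), 0 ≤ L → BoundedMeasurable f →
      (∀ x y, |f x - f y| ≤ L * D x y) →
      ∀ x y, |kernelOp K' (kernelOp K f) x - kernelOp K' (kernelOp K f) y| ≤ κ * L * D x y)
    (hdense : ∀ f : E → ℝ, MemLp f 2 π → ∀ ε : ℝ, 0 < ε → ∃ (g : E → ℝ) (L : ℝ),
      0 ≤ L ∧ BoundedMeasurable g ∧ (∀ x y, |g x - g y| ≤ L * D x y) ∧
      eLpNorm (f - g) 2 π ≤ ENNReal.ofReal ε)
    {f : E → ℝ} (hf : MemLp f 2 π) (h0 : ∫ z, f z ∂π = 0) :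
    eLpNorm (kernelOp K f) 2 π ≤ ENNReal.ofReal (Real.sqrt κ) * eLpNorm f 2 π := by
  refine ENNReal.le_of_forall_pos_le_add fun ε hε _ => ?_
  set s := Real.sqrt κ with hs
  have hs0 : 0 ≤ s := Real.sqrt_nonneg κ
  set δ : ℝ := ε / (2 * (1 + s)) with hδ
  have hδ0 : 0 < δ := by positivity
  obtain ⟨g, L, hL0, hg, hL, hfg⟩ := hdense f hf δ hδ0
  have hgm := hg.memLp π
  have hfi : Integrable f π := hf.integrable (by norm_num)
  -- centre the approximation
  set a := ∫ z, g z ∂π with ha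
  have ha_le : ‖a‖ₑ ≤ ENNReal.ofReal δ := by
    have e : a = -∫ z, (f - g) z ∂π := by
      simp only [Pi.sub_apply]
      rw [integral_sub hfi (hg.integrable π), h0, zero_sub, neg_neg]
    rw [e, enorm_neg]
    refine (enorm_integral_le_lintegral_enorm _).trans ?_
    rw [← eLpNorm_one_eq_lintegral_enorm]
    exact (eLpNorm_le_eLpNorm_of_exponent_le (by norm_num) (hf.sub hgm).1).trans hfg
  set g' : E → ℝ := fun z => g z - a with hg'
  have hgb : BoundedMeasurable g' := hg.sub_const a
  have hg'm := hgb.memLp π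
  have hfg' : eLpNorm (f - g') 2 π ≤ ENNReal.ofReal (2 * δ) := by
    have e : f - g' = (f - g) + fun _ => a := by
      ext z
      simp only [hg', Pi.sub_apply, Pi.add_apply]
      ring
    rw [e]
    refine (eLpNorm_add_le (hf.sub hgm).1 aestronglyMeasurable_const one_le_two).trans ?_
    rw [eLpNorm_const a two_ne_zero (NeZero.ne π), measure_univ, ENNReal.one_rpow, mul_one,
      two_mul, ENNReal.ofReal_add hδ0.le hδ0.le]
    exact add_le_add hfg ha_le
  have hg0 : ∫ z, g' z ∂π = 0 := by
    simp only [hg']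
    rw [integral_sub (hg.integrable π) (integrable_const a), integral_const, probReal_univ,
      one_smul, ← ha, sub_self]
  have hKg : eLpNorm (kernelOp K g') 2 π ≤ ENNReal.ofReal s * eLpNorm g' 2 π := by
    have h1 := h.integral_sq_kernelOp_le_of_lipschitz hD hκ hQ hL0 hgb
      (fun x y => by simpa [hg'] using hL x y) hg0
    refine (ENNReal.pow_le_pow_left_iff two_ne_zero).1 ?_
    rw [mul_pow, eLpNorm_two_sq_eq_integral hg'm,
      eLpNorm_two_sq_eq_integral ((hgb.kernelOp K).memLp π), ← ENNReal.ofReal_pow hs0,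
      Real.sq_sqrt hκ.le, ← ENNReal.ofReal_mul hκ.le]
    exact ENNReal.ofReal_le_ofReal h1
  have hsplit : kernelOp K f =ᵐ[π] kernelOp K (f - g') + kernelOp K g' := by
    filter_upwards [h.ae_integrable hfi] with z hz
    simp only [kernelOp, Pi.add_apply, Pi.sub_apply]
    rw [integral_sub hz (hgb.integrable (K z)), sub_add_cancel]
  have hg_le : eLpNorm g' 2 π ≤ eLpNorm f 2 π + ENNReal.ofReal (2 * δ) := by
    have e : g' = f - (f - g') := by simp
    calc eLpNorm g' 2 π = eLpNorm (f - (f - g')) 2 π := by rw [← e]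
      _ ≤ eLpNorm f 2 π + eLpNorm (f - g') 2 π :=
        eLpNorm_sub_le hf.1 (hf.sub hg'm).1 one_le_two
      _ ≤ _ := by gcongr
  calc eLpNorm (kernelOp K f) 2 π = eLpNorm (kernelOp K (f - g') + kernelOp K g') 2 π :=
        eLpNorm_congr_ae hsplit
    _ ≤ eLpNorm (kernelOp K (f - g')) 2 π + eLpNorm (kernelOp K g') 2 π :=
        eLpNorm_add_le (h.aestronglyMeasurable_kernelOp (hf.sub hg'm).1)
          (h.aestronglyMeasurable_kernelOp hg'm.1) one_le_two
    _ ≤ ENNReal.ofReal (2 * δ)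
        + ENNReal.ofReal s * (eLpNorm f 2 π + ENNReal.ofReal (2 * δ)) :=
        add_le_add ((h.eLpNorm_kernelOp_le (hf.sub hg'm).1).trans hfg')
          (hKg.trans (by gcongr))
    _ = ENNReal.ofReal s * eLpNorm f 2 π + ENNReal.ofReal (2 * δ * (1 + s)) := by
        rw [mul_add, ← ENNReal.ofReal_mul hs0, mul_add, mul_one,
          ENNReal.ofReal_add (by positivity) (by positivity), mul_comm s (2 * δ)]
        ring
    _ = ENNReal.ofReal s * eLpNorm f 2 π + ε := by
        congr 1
        have e : 2 * δ * (1 + s) = ε := by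
          rw [hδ]
          field_simp
        rw [e, ENNReal.ofReal_coe_nnreal]

end

/-! ### Contraction of the RHMC semigroup in `L²` -/

section

variable {d : ℕ} {H : Matrix (Fin d) (Fin d) ℝ} {m : ℝ}

/-- The distance whose square is `crossEnergy H (√m / 4)`. -/
noncomputable def crossDist (H : Matrix (Fin d) (Fin d) ℝ) (m : ℝ) (x y : Phase d) : ℝ :=
  Real.sqrt (crossEnergy H (Real.sqrt m / 4) (x - y))

theorem crossDist_sq (hm : 0 < m)
    (hmH : (H - m • (1 : Matrix (Fin d) (Fin d) ℝ)).PosSemidef) (x y : Phase d) :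
    crossDist H m x y ^ 2 = crossEnergy H (Real.sqrt m / 4) (x - y) :=
  Real.sq_sqrt (crossEnergy_nonneg hm hmH _)

theorem crossDist_nonneg (H : Matrix (Fin d) (Fin d) ℝ) (m : ℝ) (x y : Phase d) :
    0 ≤ crossDist H m x y := Real.sqrt_nonneg _

theorem crossDist_flip_le (hm : 0 < m)
    (hmH : (H - m • (1 : Matrix (Fin d) (Fin d) ℝ)).PosSemidef) (x y : Phase d) :
    crossDist H m (flip x) (flip y) ≤ Real.sqrt (5 / 3) * crossDist H m x y := by
  rw [crossDist, crossDist, ← Real.sqrt_mul (by norm_num), flip_sub]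
  exact Real.sqrt_le_sqrt (crossEnergy_flip_le hm hmH _)

theorem norm_le_crossDist (hm : 0 < m)
    (hmH : (H - m • (1 : Matrix (Fin d) (Fin d) ℝ)).PosSemidef) (x y : Phase d) :
    ‖x - y‖ ≤ Real.sqrt (4 / 3 * (1 / m + 1)) * crossDist H m x y := by
  rw [crossDist, ← Real.sqrt_mul (by positivity)]
  refine Real.le_sqrt_of_sq_le ?_
  set w := x - y
  have h1 := le_crossEnergy hm hmH w
  have h2 : ‖w‖ ^ 2 ≤ ‖w.1‖ ^ 2 + ‖w.2‖ ^ 2 := by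
    rw [Prod.norm_def]
    rcases max_cases ‖w.1‖ ‖w.2‖ with h | h <;> rw [h.1] <;>
      nlinarith [sq_nonneg ‖w.1‖, sq_nonneg ‖w.2‖]
  have h3 : ‖w.1‖ ^ 2 + ‖w.2‖ ^ 2 ≤ (1 / m + 1) * (m * ‖w.1‖ ^ 2 + ‖w.2‖ ^ 2) := by
    have e : (1 / m + 1) * (m * ‖w.1‖ ^ 2 + ‖w.2‖ ^ 2)
        = ‖w.1‖ ^ 2 + ‖w.2‖ ^ 2 + (m * ‖w.1‖ ^ 2 + 1 / m * ‖w.2‖ ^ 2) := by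
      field_simp
      ring
    rw [e]
    have : 0 ≤ m * ‖w.1‖ ^ 2 + 1 / m * ‖w.2‖ ^ 2 := by positivity
    linarith
  have h4 : 0 ≤ 1 / m + 1 := by positivity
  nlinarith [mul_le_mul_of_nonneg_left h1 h4]

theorem integrable_crossDist_sq (hm : 0 < m)
    (hmH : (H - m • (1 : Matrix (Fin d) (Fin d) ℝ)).PosSemidef) (c : Vec d) :
    Integrable (fun q : Phase d × Phase d => crossDist H m q.1 q.2 ^ 2)
      ((target H c).prod (target H c)) := by
  simp_rw [crossDist_sq hm hmH]
  have hG : MemLp (fun z : Phase d => z) 2 (target H c) := by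
    have : IsGaussian (target H c) := by unfold target; infer_instance
    exact IsGaussian.memLp_two_id
  have hN : Integrable (fun z : Phase d => ‖z‖ ^ 2) (target H c) :=
    hG.integrable_norm_pow two_ne_zero
  have hb : ∀ w : Phase d, crossEnergy H (Real.sqrt m / 4) w ≤ 2 * (‖act H‖ + 1) * ‖w‖ ^ 2 := by
    intro w
    have h1 := abs_le.1 (abs_cross_le hm hmH w)
    have h2 : inner ℝ w.1 (act H w.1) ≤ ‖act H‖ * ‖w.1‖ ^ 2 := by
      refine (real_inner_le_norm _ _).trans ?_
      have := (act H).le_opNorm w.1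
      nlinarith [norm_nonneg w.1]
    have h3 : ‖w.1‖ ^ 2 ≤ ‖w‖ ^ 2 := by gcongr; exact norm_fst_le w
    have h4 : ‖w.2‖ ^ 2 ≤ ‖w‖ ^ 2 := by gcongr; exact norm_snd_le w
    have h5 := mul_le_mul_of_nonneg_left h3 (norm_nonneg (act H))
    rw [crossEnergy]
    have h0 : 0 ≤ inner ℝ w.1 (act H w.1) := le_trans (by positivity) (le_inner_act hmH w.1)
    nlinarith [h1.2, sq_nonneg ‖w.2‖]
  refine Integrable.mono' (g := fun q => 4 * (‖act H‖ + 1) * (‖q.1‖ ^ 2 + ‖q.2‖ ^ 2)) ?_ ?_ ?_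
  · exact ((hN.comp_fst _).add (hN.comp_snd _)).const_mul _
  · exact ((continuous_crossEnergy H _).comp
      (continuous_fst.sub continuous_snd)).aestronglyMeasurable
  · refine Filter.Eventually.of_forall fun q => ?_
    rw [Real.norm_of_nonneg (crossEnergy_nonneg hm hmH _)]
    have h1 := norm_sub_le q.1 q.2
    have h2 : ‖q.1 - q.2‖ ^ 2 ≤ 2 * (‖q.1‖ ^ 2 + ‖q.2‖ ^ 2) := by
      nlinarith [norm_nonneg (q.1 - q.2), sq_nonneg (‖q.1‖ - ‖q.2‖), norm_nonneg q.1,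
        norm_nonneg q.2]
    have h3 : 0 ≤ 2 * (‖act H‖ + 1) := by positivity
    nlinarith [hb (q.1 - q.2), mul_le_mul_of_nonneg_left h2 h3]

/-- Smooth compactly supported functions are Lipschitz for `crossDist` and dense in `L²`. -/
theorem exists_lipschitz_eLpNorm_sub_le (hm : 0 < m)
    (hmH : (H - m • (1 : Matrix (Fin d) (Fin d) ℝ)).PosSemidef) (c : Vec d) {f : Phase d → ℝ}
    (hf : MemLp f 2 (target H c)) {ε : ℝ} (hε : 0 < ε) :
    ∃ (g : Phase d → ℝ) (L : ℝ), 0 ≤ L ∧ BoundedMeasurable g ∧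
      (∀ x y, |g x - g y| ≤ L * crossDist H m x y) ∧
      eLpNorm (f - g) 2 (target H c) ≤ ENNReal.ofReal ε := by
  obtain ⟨g, hgc, hgs, hg⟩ := hf.exist_eLpNorm_sub_le (by norm_num) one_le_two hε
  obtain ⟨C, hC⟩ := hgs.lipschitzWith_of_hasCompactSupport hgc (by simp)
  obtain ⟨B, hB⟩ := hgc.exists_bound_of_continuous hgs.continuous
  refine ⟨g, C * Real.sqrt (4 / 3 * (1 / m + 1)), by positivity,
    ⟨hgs.continuous.measurable, B, hB⟩, fun x y => ?_, hg⟩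
  have h1 := hC.dist_le_mul x y
  rw [Real.dist_eq, dist_eq_norm] at h1
  rw [mul_assoc]
  exact h1.trans (mul_le_mul_of_nonneg_left (norm_le_crossDist hm hmH x y) C.2)

/-- The synchronous coupling shows that the transition kernel contracts Lipschitz constants with
respect to `crossDist`. -/
theorem abs_kernelOp_transition_sub_le (hm : 0 < m)
    (hmH : (H - m • (1 : Matrix (Fin d) (Fin d) ℝ)).PosSemidef) (c : Vec d) {α lam μ : ℝ}
    (hα0 : 0 ≤ α) (hα1 : α < 1) (hlam : lam = 2 * Real.sqrt m / (1 - α))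
    (hμ : μ = Real.sqrt m / 3) [IsProbabilityMeasure (expMeasure lam)] {t : ℝ} (ht : 0 ≤ t)
    {L : ℝ} (hL0 : 0 ≤ L) {f : Phase d → ℝ} (hf : BoundedMeasurable f)
    (hL : ∀ x y, |f x - f y| ≤ L * crossDist H m x y) (x y : Phase d) :
    |kernelOp (transition H c α lam t) f x - kernelOp (transition H c α lam t) f y|
      ≤ Real.exp (-μ * t / 2) * L * crossDist H m x y := by
  have e : ∀ z, kernelOp (transition H c α lam t) f z
      = ∫ ω, f (path H c α z t ω) ∂(noise d lam) := fun z => by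
    rw [kernelOp, transition_apply, integral_map (measurable_path_right H c α z t).aemeasurable
      hf.measurable.aestronglyMeasurable]
  have hi : ∀ z, Integrable (fun ω => f (path H c α z t ω)) (noise d lam) := fun z =>
    (hf.comp (measurable_path_right H c α z t)).integrable _
  set X : (ℕ → ℝ × Vec d) → ℝ := fun ω => crossDist H m (path H c α x t ω) (path H c α y t ω)
    with hX
  have hX2 : ∀ ω, X ω ^ 2 = crossEnergy H (Real.sqrt m / 4)
      (path H c α x t ω - path H c α y t ω) := fun ω => crossDist_sq hm hmH _ _
  have hXm : Measurable X := (measurable_crossEnergy_path_sub H _ c α t y x).sqrt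
  have hXL : MemLp X 2 (noise d lam) := by
    rw [memLp_two_iff_integrable_sq hXm.aestronglyMeasurable]
    simp_rw [hX2]
    exact integrable_crossEnergy_path hm hmH c hα0 hα1 hlam y x ht
  have hXi : Integrable X (noise d lam) := hXL.integrable (by norm_num)
  have hmean : ∫ ω, X ω ∂(noise d lam) ≤ Real.exp (-μ * t / 2) * crossDist H m x y := by
    have h1 : (∫ ω, X ω ∂(noise d lam)) ^ 2 ≤ ∫ ω, X ω ^ 2 ∂(noise d lam) := by
      have h2 := variance_nonneg X (noise d lam)
      rw [variance_eq_sub hXL] at h2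
      simpa using h2
    simp_rw [hX2] at h1
    have h3 := h1.trans (integral_crossEnergy_path_le hm hmH c hα0 hα1 hlam hμ y x ht)
    rw [← crossDist_sq hm hmH] at h3
    refine le_of_sq_le_sq (h3.trans_eq ?_)
      (mul_nonneg (Real.exp_nonneg _) (crossDist_nonneg H m x y))
    rw [mul_pow, ← Real.exp_nat_mul]
    congr 2
    push_cast
    ring
  rw [e, e, ← integral_sub (hi x) (hi y)]
  calc |∫ ω, f (path H c α x t ω) - f (path H c α y t ω) ∂(noise d lam)|
      ≤ ∫ ω, |f (path H c α x t ω) - f (path H c α y t ω)| ∂(noise d lam) :=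
        abs_integral_le_integral_abs
    _ ≤ ∫ ω, L * X ω ∂(noise d lam) :=
        integral_mono ((hi x).sub (hi y)).abs (hXi.const_mul L) fun ω => hL _ _
    _ = L * ∫ ω, X ω ∂(noise d lam) := integral_const_mul _ _
    _ ≤ L * (Real.exp (-μ * t / 2) * crossDist H m x y) := mul_le_mul_of_nonneg_left hmean hL0
    _ = _ := by ring

theorem kernelOp_flippedTransition (H : Matrix (Fin d) (Fin d) ℝ) (c : Vec d) (α lam t : ℝ)
    [IsProbabilityMeasure (expMeasure lam)] {f : Phase d → ℝ} (hf : BoundedMeasurable f)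
    (z : Phase d) :
    kernelOp (flippedTransition H c α lam t) f z
      = kernelOp (transition H c α lam t) (fun y => f (flip y)) (flip z) := by
  rw [kernelOp, flippedTransition_apply, integral_map measurable_flip.aemeasurable
    hf.measurable.aestronglyMeasurable, kernelOp]

/-- A step of the process followed by a step of its time reversal contracts Lipschitz constants.
Each step contributes `exp (-μ t / 2)`, and each of the two velocity flips `√(5/3)`. -/
theorem abs_kernelOp_flippedTransition_sub_le (hm : 0 < m)
    (hmH : (H - m • (1 : Matrix (Fin d) (Fin d) ℝ)).PosSemidef) (c : Vec d) {α lam μ : ℝ}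
    (hα0 : 0 ≤ α) (hα1 : α < 1) (hlam : lam = 2 * Real.sqrt m / (1 - α))
    (hμ : μ = Real.sqrt m / 3) [IsProbabilityMeasure (expMeasure lam)] {t : ℝ} (ht : 0 ≤ t)
    {L : ℝ} (hL0 : 0 ≤ L) {f : Phase d → ℝ} (hf : BoundedMeasurable f)
    (hL : ∀ x y, |f x - f y| ≤ L * crossDist H m x y) (x y : Phase d) :
    |kernelOp (flippedTransition H c α lam t) (kernelOp (transition H c α lam t) f) x
        - kernelOp (flippedTransition H c α lam t) (kernelOp (transition H c α lam t) f) y|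
      ≤ 5 / 3 * Real.exp (-μ * t) * L * crossDist H m x y := by
  set r := Real.sqrt (5 / 3) with hr
  set e := Real.exp (-μ * t / 2) with he
  have hr0 : 0 ≤ r := Real.sqrt_nonneg _
  have hr2 : r * r = 5 / 3 := Real.mul_self_sqrt (by norm_num)
  have he2 : e * e = Real.exp (-μ * t) := by
    rw [he, ← Real.exp_add]
    congr 1
    ring
  have hKf := hf.kernelOp (transition H c α lam t)
  have h1 : ∀ x y, |kernelOp (transition H c α lam t) f (flip x)
      - kernelOp (transition H c α lam t) f (flip y)| ≤ e * L * r * crossDist H m x y := by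
    intro x y
    refine (abs_kernelOp_transition_sub_le hm hmH c hα0 hα1 hlam hμ ht hL0 hf hL _ _).trans ?_
    rw [mul_assoc (e * L)]
    exact mul_le_mul_of_nonneg_left (crossDist_flip_le hm hmH x y) (by positivity)
  rw [kernelOp_flippedTransition H c α lam t hKf, kernelOp_flippedTransition H c α lam t hKf]
  refine (abs_kernelOp_transition_sub_le hm hmH c hα0 hα1 hlam hμ ht (by positivity)
    (hKf.comp measurable_flip) h1 _ _).trans ?_
  calc e * (e * L * r) * crossDist H m (flip x) (flip y)
      ≤ e * (e * L * r) * (r * crossDist H m x y) :=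
        mul_le_mul_of_nonneg_left (crossDist_flip_le hm hmH x y) (by positivity)
    _ = r * r * (e * e) * L * crossDist H m x y := by ring
    _ = _ := by rw [hr2, he2]

theorem isDual_transition (hH : H.PosDef) (c : Vec d) {α lam : ℝ} (hα0 : 0 ≤ α)
    (hα1 : α < 1) (hlam : 0 < lam) [IsProbabilityMeasure (expMeasure lam)] {t : ℝ} (ht : 0 ≤ t) :
    IsDual (target H c) (transition H c α lam t) (flippedTransition H c α lam t) :=
  fun _ _ hf hg => lintegral_mul_transition hH c hα0 hα1 hlam ht hf hg

/-- For an `L²` function, which need not be measurable, the semigroup agrees almost everywhere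
with the action of the transition kernel. -/
theorem semigroup_ae_eq (hH : H.PosDef) (c : Vec d) {α lam : ℝ} (hα0 : 0 ≤ α)
    (hα1 : α < 1) (hlam : 0 < lam) [IsProbabilityMeasure (expMeasure lam)] {t : ℝ} (ht : 0 ≤ t)
    {f : Phase d → ℝ} (hf : AEStronglyMeasurable f (target H c)) :
    semigroup H c α lam t f =ᵐ[target H c] kernelOp (transition H c α lam t) f := by
  filter_upwards [(isDual_transition hH c hα0 hα1 hlam ht).ae_ae hf.ae_eq_mk] with z hz
  have hfz : AEStronglyMeasurable f (transition H c α lam t z) :=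
    ⟨hf.mk f, hf.stronglyMeasurable_mk, hz⟩
  rw [kernelOp, transition_apply, integral_map (measurable_path_right H c α z t).aemeasurable hfz]
  rfl

theorem decayConst_one_quarter_one : decayConst 1 (1 / 4) 1 = 5 / 3 := by
  have h : Real.sqrt (1 * 1 * (1 / 4) ^ 2) = 1 / 4 := by
    rw [one_mul, one_mul]
    exact Real.sqrt_sq (by norm_num)
  rw [decayConst, h]
  norm_num

theorem memLp_semigroup_and_integral_sq_le (hm : 0 < m)
    (hmH : (H - m • (1 : Matrix (Fin d) (Fin d) ℝ)).PosSemidef) (c : Vec d) {α lam μ : ℝ}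
    (hα0 : 0 ≤ α) (hα1 : α < 1) (hlam : lam = 2 * Real.sqrt m / (1 - α))
    (hμ : μ = Real.sqrt m / 3) {f : Phase d → ℝ} (hf : MemLp f 2 (target H c))
    (h0 : ∫ z, f z ∂(target H c) = 0) {t : ℝ} (ht : 0 ≤ t) :
    MemLp (semigroup H c α lam t f) 2 (target H c) ∧
      ∫ z, (semigroup H c α lam t f z) ^ 2 ∂(target H c)
        ≤ min (5 / 3 * Real.exp (-μ * t)) 1 * ∫ z, (f z) ^ 2 ∂(target H c) := by
  have hlam0 := pos_rate hm hα1 hlam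
  have := isProbabilityMeasure_expMeasure hlam0
  have hH := posDef_of_posSemidef_sub hm hmH
  have hdual := isDual_transition hH c hα0 hα1 hlam0 ht
  have hae := semigroup_ae_eq hH c hα0 hα1 hlam0 ht hf.1
  set κ := 5 / 3 * Real.exp (-μ * t) with hκdef
  have hκ : 0 < κ := by positivity
  have hle := hdual.eLpNorm_kernelOp_le hf.1
  have hle' := hdual.eLpNorm_kernelOp_le_of_lipschitz (integrable_crossDist_sq hm hmH c) hκ
    (fun L g hL0 hg hL x y =>
      abs_kernelOp_flippedTransition_sub_le hm hmH c hα0 hα1 hlam hμ ht hL0 hg hL x y)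
    (fun g hg ε hε => exists_lipschitz_eLpNorm_sub_le hm hmH c hg hε) hf h0
  rw [← eLpNorm_congr_ae hae] at hle hle'
  have hmem : MemLp (semigroup H c α lam t f) 2 (target H c) :=
    ⟨(hdual.aestronglyMeasurable_kernelOp hf.1).congr hae.symm, hle.trans_lt hf.2⟩
  refine ⟨hmem, ?_⟩
  have hI : 0 ≤ ∫ z, (f z) ^ 2 ∂(target H c) := integral_nonneg fun z => sq_nonneg _
  have h1 : ∫ z, (semigroup H c α lam t f z) ^ 2 ∂(target H c) ≤ ∫ z, (f z) ^ 2 ∂(target H c) := by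
    have h := pow_le_pow_left₀ zero_le hle 2
    rw [eLpNorm_two_sq_eq_integral hmem, eLpNorm_two_sq_eq_integral hf] at h
    exact (ENNReal.ofReal_le_ofReal_iff hI).1 h
  have h2 : ∫ z, (semigroup H c α lam t f z) ^ 2 ∂(target H c)
      ≤ κ * ∫ z, (f z) ^ 2 ∂(target H c) := by
    have h := pow_le_pow_left₀ zero_le hle' 2
    rw [mul_pow, eLpNorm_two_sq_eq_integral hmem, eLpNorm_two_sq_eq_integral hf,
      ← ENNReal.ofReal_pow (Real.sqrt_nonneg _), Real.sq_sqrt hκ.le,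
      ← ENNReal.ofReal_mul hκ.le] at h
    exact (ENNReal.ofReal_le_ofReal_iff (mul_nonneg hκ.le hI)).1 h
  rcases min_cases κ 1 with h | h <;> rw [h.1]
  · exact h2
  · simpa using h1

end

end RHMC

theorem mainTheorem4 (d : ℕ) (c : RHMC.Vec d) (H : Matrix (Fin d) (Fin d) ℝ) (m M α lam μ : ℝ)
    (hm : 0 < m)
    (hmH : (H - m • (1 : Matrix (Fin d) (Fin d) ℝ)).PosSemidef)
    (hHM : (M • (1 : Matrix (Fin d) (Fin d) ℝ) - H).PosSemidef)
    (hα0 : 0 ≤ α) (hα1 : α < 1)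
    (hlam : lam = 2 * Real.sqrt m / (1 - α))
    (hμ : μ = Real.sqrt m / 3) :
    (∃ D : Matrix (Fin d ⊕ Fin d) (Fin d ⊕ Fin d) ℝ, D.PosDef ∧
      (∀ z₁ z₂ : RHMC.Phase d,
        RHMC.coupledGenerator (RHMC.gaussianPotential H c) α lam (RHMC.sqDist D) (z₁, z₂)
          ≤ -μ * RHMC.sqDist D (z₁, z₂)) ∧
      (∀ (z₁ z₂ : RHMC.Phase d) (t : ℝ), 0 ≤ t →
        Integrable (fun ω => RHMC.sqDist D (RHMC.path H c α z₁ t ω, RHMC.path H c α z₂ t ω))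
          (RHMC.noise d lam) ∧
        ∫ ω, RHMC.sqDist D (RHMC.path H c α z₁ t ω, RHMC.path H c α z₂ t ω) ∂(RHMC.noise d lam)
          ≤ Real.exp (-μ * t) * RHMC.sqDist D (z₁, z₂))) ∧
    (∀ f : RHMC.Phase d → ℝ, MemLp f 2 (RHMC.target H c) → ∫ z, f z ∂(RHMC.target H c) = 0 →
      ∀ t : ℝ, 0 ≤ t →
        MemLp (RHMC.semigroup H c α lam t f) 2 (RHMC.target H c) ∧
        ∫ z, (RHMC.semigroup H c α lam t f z) ^ 2 ∂(RHMC.target H c)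
          ≤ min (RHMC.decayConst 1 (1 / 4) 1 * Real.exp (-μ * t)) 1
            * ∫ z, (f z) ^ 2 ∂(RHMC.target H c)) := by
  have hlam0 := RHMC.pos_rate hm hα1 hlam
  have := isProbabilityMeasure_expMeasure hlam0
  have hH := RHMC.isHermitian_of_posSemidef_sub hmH
  refine ⟨⟨RHMC.crossEnergyMatrix H (Real.sqrt m / 4), RHMC.posDef_crossEnergyMatrix hm hmH,
    fun z₁ z₂ => ?_, fun z₁ z₂ t ht => ?_⟩, fun f hf h0 t ht => ?_⟩
  · rw [RHMC.coupledGenerator_sqDist hH, RHMC.sqDist_crossEnergyMatrix]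
    exact RHMC.crossEnergyDeriv_fieldCLM_add_le hm hmH hα0 hα1 hlam hμ _
  · simp only [RHMC.sqDist_crossEnergyMatrix]
    exact ⟨RHMC.integrable_crossEnergy_path hm hmH c hα0 hα1 hlam z₁ z₂ ht,
      RHMC.integral_crossEnergy_path_le hm hmH c hα0 hα1 hlam hμ z₁ z₂ ht⟩
  · rw [RHMC.decayConst_one_quarter_one]
    exact RHMC.memLp_semigroup_and_integral_sq_le hm hmH c hα0 hα1 hlam hμ hf h0 ht
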